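/- Let $\mathcal P$ be a finite nonempty set of atomic propositions, $\Sigma=2^{\mathcal P}$. For an infinite word $\alpha=\alpha[0]\alpha[1]\cdots\in\Sigma^\omega$ let $\alpha[i,\infty)$ be its suffix from position $i$ and $\alpha[i,j)$ its infix from position $i$ up to and excluding $j$. **Logic.** Atomic expressions: $\xi::=p\mid\neg\xi\mid\xi\vee\xi$ with $p\in\mathcal P$. Regular expressions: $\rho::=\varepsilon\mid\xi\mid\rho+\rho\mid\rho\circ\rho\mid\rho^*$. PSL formulas: $\varphi::=p\mid\neg\varphi\mid\varphi\vee\varphi\mid \mathbf X\varphi\mid\varphi\,\mathbf U\,\varphi\mid\rho\mapsto\varphi$. An atomic expression denotes a set of symbols ($p$ denotes $\{A\in\Sigma: p\in A\}$; $\neg$ is complement, $\vee$ is union), and $\alpha[i,j)\vdash\rho$ ("matches") is the usual membership of the finite word $\alpha[i,j)$ in the language of $\rho$, where $\xi$ matches exactly the one-letter words whose letter it denotes. $\alpha\models\varphi$ is the usual LTL semantics, with $\alpha\models\rho\mapsto\varphi$ iff for all $i\ge1$, $\alpha[0,i)\vdash\rho$ implies $\alpha[i-1,\infty)\models\varphi$.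 The size $|\varphi|$ is the number of distinct subformulas and subexpressions of $\varphi$ (a propositional formula and the same atomic expression count once). A sample $\mathcal S=(P,N)$ consists of two finite sets of ultimately periodic words $uv^\omega$ ($v\ne\varepsilon$), each given by a pair $(u,v)$, such that no word is in both. A formula $\varphi$ is consistent with $\mathcal S$ if all words of $P$ and no word of $N$ satisfy it. **Encoding.** For $n\ge1$ let $b=2^n+1$. The propositional formula $\Phi_n^{\mathcal S}=\Phi_n^{\mathrm{str}}\wedge\Phi_n^{\mathrm{cst}}$ has variables $x_{k,\lambda}$ (node $k$ has label $\lambda$), $l_{k,\ell}$, $r_{k,\ell}$ (node $\ell<k$ is the left, right child of node $k$), $a_k$ (node $k$ is an atomic expression), and, for each word $uv^\omega$ of the sample, $y^{u,v}_{i,k}$ ($0\le i<|uv|$) and $z^{u,v}_{i,j,k}$ ($0\le i\le j\le|uv^b|$); here $1\le k\le n$. Put $\Lambda_A=\{\neg,\vee\}\cup\mathcal P$, $\Lambda_R=\Lambda_A\cup\{\varepsilon,+,\circ,{}^*\}$, $\Lambda_F=\Lambda_A\cup\{\mathbf X,\mathbf U,\mapsto\}$. $\Phi_n^{\mathrm{str}}$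 says: every node has exactly one label in $\Lambda_R\cup\Lambda_F$; every node $k\ge2$ has exactly one left and exactly one right child, both in $\{1,\dots,k-1\}$; both children of a node labelled $+,\circ,{}^*$ have labels in $\Lambda_R$; both children of a node labelled $\mathbf X,\mathbf U,\neg,\vee$ have labels in $\Lambda_F$; the left child of a node labelled $\mapsto$ has a label in $\Lambda_R$ and its right child one in $\Lambda_F$; if $a_k$ holds, then node $k$ has a label in $\Lambda_A$, and $a_\ell$ holds for its left child $\ell$ if the label is $\neg$, and for both its children if it is $\vee$; $a_\ell$ holds for every $\ell$ labelled $\neg$ or $\vee$ that is the left child of a node labelled $+,\circ,{}^*,\mapsto$ or the right child of a node labelled $+,\circ$; node $1$ is labelled $\varepsilon$ or by a proposition; node $n$ has a label in $\Lambda_F$. $\Phi_n^{\mathrm{cst}}$ is $\bigwedge_{uv^\omega\in P}(\Phi_n^{u,v}\wedge y^{u,v}_{0,n})\wedge\bigwedge_{uv^\omega\in N}(\Phi_n^{u,v}\wedge\neg y^{u,v}_{0,n})$. With superscripts omitted, $\Phi_n^{u,v}$ says, for every node $k$ with left child $\ell$ and right child $\ell'$, according to its label: - for all $0\le i\le j\le|uv^b|$: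 $\varepsilon$: $z_{i,j,k}\leftrightarrow[i=j]$; $p$: $z_{i,j,k}\leftrightarrow[j=i+1\text{ and }p\in uv^\omega[i]]$; $\neg$: $z_{i,j,k}\leftrightarrow[j=i+1]\wedge\neg z_{i,j,\ell}$; $\vee$ and $+$: $z_{i,j,k}\leftrightarrow z_{i,j,\ell}\vee z_{i,j,\ell'}$; $\circ$: $z_{i,j,k}\leftrightarrow\bigvee_{i\le t\le j}z_{i,t,\ell}\wedge z_{t,j,\ell'}$; ${}^*$: $z_{i,j,k}\leftrightarrow[i=j]\vee\bigvee_{i<t\le j}z_{i,t,\ell}\wedge z_{t,j,k}$; - for all $0\le i<|uv|$: $p$: $y_{i,k}\leftrightarrow[p\in uv^\omega[i]]$; $\neg$: $y_{i,k}\leftrightarrow\neg y_{i,\ell}$; $\vee$: $y_{i,k}\leftrightarrow y_{i,\ell}\vee y_{i,\ell'}$; $\mathbf X$: $y_{i,k}\leftrightarrow y_{i+1,\ell}$ if $i<|uv|-1$, and $y_{i,k}\leftrightarrow y_{|u|,\ell}$ if $i=|uv|-1$; $\mathbf U$: $y_{i,k}\leftrightarrow\bigvee_{i\le j<|uv|}\big(y_{j,\ell'}\wedge\bigwedge_{i\le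 t<j}y_{t,\ell}\big)$ if $i<|u|$, and $y_{i,k}\leftrightarrow\bigvee_{|u|\le j<|uv|}\big(y_{j,\ell'}\wedge\bigwedge_{t\in I(i,j)}y_{t,\ell}\big)$ if $i\ge|u|$, where $I(i,j)=\{i,\dots,j-1\}$ for $i\le j$ and $\{|u|,\dots,j-1\}\cup\{i,\dots,|uv|-1\}$ for $i>j$; $\mapsto$: $y_{i,k}\leftrightarrow\bigwedge_{i<j\le|uv^b|}\big(z_{i,j,\ell}\to y_{M(j-1),\ell'}\big)$, where $M(j)=j$ for $j<|uv|$ and $M(j)=|u|+((j-|u|)\bmod|v|)$ otherwise. For a model $v$ of $\Phi_n^{\mathcal S}$, $\varphi_v$ is the PSL formula whose syntax tree is obtained by unravelling, from node $n$, the labels and children given by $v$ (ignoring the right child of unary nodes and both children of leaves). **Algorithm 1.** On input $\mathcal S$: for $n=1,2,\dots$ construct $\Phi_n^{\mathcal S}$ and check its satisfiability; as soon as it is satisfiable, with some model $v$, return $\varphi_v$. **Theorem.** For every sample $\mathcal S$, Algorithm 1 terminates (whichever models are found) and returns a PSL formula that is consistent with $\mathcal S$ and has minimal size among all PSL formulas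 consistent with $\mathcal S$. Moreover, for every $n\ge1$, $\Phi_n^{\mathcal S}$ is satisfiable if and only if some PSL formula of size $n$ is consistent with $\mathcal S$, and for every model $v$ of $\Phi_n^{\mathcal S}$ the formula $\varphi_v$ exists, is unique, is consistent with $\mathcal S$ and has size at most $n$. -/

import Mathlib

namespace PSLLearning

/-! ### Ultimately periodic words -/

/-- An infinite word over the alphabet `2^AP`. -/
abbrev InfWord (AP : Type*) := ℕ → Finset AP

/-- The suffix `α[i, ∞)`. -/
def InfWord.suffix {AP : Type*} (α : InfWord AP) (i : ℕ) : InfWord AP := fun j => α (i + j)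

/-- A finite presentation `(u, v)`, `v ≠ ε`, of the ultimately periodic word `u v^ω`. -/
structure UPWord (AP : Type*) where
  u : List (Finset AP)
  v : List (Finset AP)
  v_ne : v ≠ []

/-- The infinite word `u v^ω`. -/
def UPWord.word {AP : Type*} (w : UPWord AP) : InfWord AP := fun i =>
  if h : i < w.u.length then w.u[i]
  else w.v[(i - w.u.length) % w.v.length]'(Nat.mod_lt _ (List.length_pos_iff.mpr w.v_ne))

/-- `|u|` -/
def UPWord.lu {AP : Type*} (w : UPWord AP) : ℕ := w.u.length

/-- `|uv|` -/
def UPWord.luv {AP : Type*} (w : UPWord AP) : ℕ := w.u.length + w.v.length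

/-- `|u v^b|` -/
def UPWord.luvb {AP : Type*} (w : UPWord AP) (b : ℕ) : ℕ := w.u.length + b * w.v.length

/-- The map `M_{u,v}` from positions of `u v^ω` to positions of the prefix `uv`. -/
def UPWord.M {AP : Type*} (w : UPWord AP) (j : ℕ) : ℕ :=
  if j < w.luv then j else w.u.length + (j - w.u.length) % w.v.length

/-! ### Regular expressions and PSL -/

/-- Atomic expressions `ξ ::= p | ¬ξ | ξ ∨ ξ`. -/
inductive AtomExpr (AP : Type*) where
  | prop (p : AP)
  | neg (ξ : AtomExpr AP)
  | or (ξ₁ ξ₂ : AtomExpr AP)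

/-- Regular expressions `ρ ::= ε | ξ | ρ + ρ | ρ ∘ ρ | ρ*`. -/
inductive RegExpr (AP : Type*) where
  | eps
  | atom (ξ : AtomExpr AP)
  | plus (ρ₁ ρ₂ : RegExpr AP)
  | comp (ρ₁ ρ₂ : RegExpr AP)
  | star (ρ : RegExpr AP)

/-- PSL formulas `φ ::= p | ¬φ | φ ∨ φ | X φ | φ U φ | ρ ↦ φ`. -/
inductive PSL (AP : Type*) where
  | prop (p : AP)
  | neg (φ : PSL AP)
  | or (φ₁ φ₂ : PSL AP)
  | next (φ : PSL AP)
  | untl (φ₁ φ₂ : PSL AP)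
  | trig (ρ : RegExpr AP) (φ : PSL AP)

/-- The set of symbols denoted by an atomic expression. -/
def AtomExpr.sem {AP : Type*} : AtomExpr AP → Set (Finset AP)
  | .prop p => {A | p ∈ A}
  | .neg ξ => ξ.semᶜ
  | .or ξ₁ ξ₂ => ξ₁.sem ∪ ξ₂.sem

/-- `[i, j)` can be cut into finitely many nonempty consecutive pieces that all satisfy `R`. -/
inductive StarMatch (R : ℕ → ℕ → Prop) : ℕ → ℕ → Prop where
  | refl (i : ℕ) : StarMatch R i i
  | step {i k j : ℕ} (hik : i < k) (hkj : k ≤ j) (h : R i k) (h' : StarMatch R k j) :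
      StarMatch R i j

/-- The matching relation `α[i, j) ⊢ ρ`. -/
def Matches {AP : Type*} (α : InfWord AP) : RegExpr AP → ℕ → ℕ → Prop
  | .eps, i, j => j = i
  | .atom ξ, i, j => j = i + 1 ∧ α i ∈ ξ.sem
  | .plus ρ₁ ρ₂, i, j => Matches α ρ₁ i j ∨ Matches α ρ₂ i j
  | .comp ρ₁ ρ₂, i, j => ∃ k, i ≤ k ∧ k ≤ j ∧ Matches α ρ₁ i k ∧ Matches α ρ₂ k j
  | .star ρ, i, j => StarMatch (Matches α ρ) i j

/-- The satisfaction relation `α ⊨ φ`. -/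
def Sat {AP : Type*} : InfWord AP → PSL AP → Prop
  | α, .prop p => p ∈ α 0
  | α, .neg φ => ¬ Sat α φ
  | α, .or φ₁ φ₂ => Sat α φ₁ ∨ Sat α φ₂
  | α, .next φ => Sat (α.suffix 1) φ
  | α, .untl φ₁ φ₂ => ∃ j, Sat (α.suffix j) φ₂ ∧ ∀ i < j, Sat (α.suffix i) φ₁
  | α, .trig ρ φ => ∀ i, 0 < i → Matches α ρ 0 i → Sat (α.suffix (i - 1)) φ

/-! ### Syntax trees and size

Formulas and regular expressions share one type of syntax trees, in which a propositional formula
and the same atomic expression are the same tree: so `(p ∘ q) ↦ X q` has size `5`. -/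

inductive SynTree (AP : Type*) where
  | prop (p : AP)
  | eps
  | neg (t : SynTree AP)
  | or (t₁ t₂ : SynTree AP)
  | next (t : SynTree AP)
  | untl (t₁ t₂ : SynTree AP)
  | trig (t₁ t₂ : SynTree AP)
  | plus (t₁ t₂ : SynTree AP)
  | comp (t₁ t₂ : SynTree AP)
  | star (t : SynTree AP)
  deriving DecidableEq

/-- The set of all subtrees, including the tree itself. -/
def SynTree.subtrees {AP : Type*} [DecidableEq AP] : SynTree AP → Finset (SynTree AP)
  | .prop p => {.prop p}
  | .eps => {.eps}
  | .neg t => insert (.neg t) t.subtrees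
  | .or t₁ t₂ => insert (.or t₁ t₂) (t₁.subtrees ∪ t₂.subtrees)
  | .next t => insert (.next t) t.subtrees
  | .untl t₁ t₂ => insert (.untl t₁ t₂) (t₁.subtrees ∪ t₂.subtrees)
  | .trig t₁ t₂ => insert (.trig t₁ t₂) (t₁.subtrees ∪ t₂.subtrees)
  | .plus t₁ t₂ => insert (.plus t₁ t₂) (t₁.subtrees ∪ t₂.subtrees)
  | .comp t₁ t₂ => insert (.comp t₁ t₂) (t₁.subtrees ∪ t₂.subtrees)
  | .star t => insert (.star t) t.subtrees

def AtomExpr.tree {AP : Type*} : AtomExpr AP → SynTree AP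
  | .prop p => .prop p
  | .neg ξ => .neg ξ.tree
  | .or ξ₁ ξ₂ => .or ξ₁.tree ξ₂.tree

def RegExpr.tree {AP : Type*} : RegExpr AP → SynTree AP
  | .eps => .eps
  | .atom ξ => ξ.tree
  | .plus ρ₁ ρ₂ => .plus ρ₁.tree ρ₂.tree
  | .comp ρ₁ ρ₂ => .comp ρ₁.tree ρ₂.tree
  | .star ρ => .star ρ.tree

def PSL.tree {AP : Type*} : PSL AP → SynTree AP
  | .prop p => .prop p
  | .neg φ => .neg φ.tree
  | .or φ₁ φ₂ => .or φ₁.tree φ₂.tree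
  | .next φ => .next φ.tree
  | .untl φ₁ φ₂ => .untl φ₁.tree φ₂.tree
  | .trig ρ φ => .trig ρ.tree φ.tree

/-- The size of a formula: its number of distinct subformulas and subexpressions. -/
def PSL.size {AP : Type*} [DecidableEq AP] (φ : PSL AP) : ℕ := φ.tree.subtrees.card

/-! ### Samples -/

/-- A sample: two finite sets of (presentations of) ultimately periodic words such that no word
is both positive and negative. -/
structure Sample (AP : Type*) where
  P : Finset (UPWord AP)
  N : Finset (UPWord AP)
  disjoint : ∀ w ∈ P, ∀ w' ∈ N, w.word ≠ w'.word

def Sample.Consistent {AP : Type*} (S : Sample AP) (φ : PSL AP) : Prop :=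
  (∀ w ∈ S.P, Sat w.word φ) ∧ ∀ w ∈ S.N, ¬ Sat w.word φ

/-! ### Propositional logic -/

/-- Propositional formulas over a set `V` of variables. -/
inductive PropForm (V : Type*) where
  | var (x : V)
  | ff
  | neg (Φ : PropForm V)
  | or (Φ Ψ : PropForm V)

namespace PropForm

variable {V ι : Type*}

def Holds (v : V → Bool) : PropForm V → Prop
  | .var x => v x = true
  | .ff => False
  | .neg Φ => ¬ Holds v Φ
  | .or Φ Ψ => Holds v Φ ∨ Holds v Ψ

def Satisfiable (Φ : PropForm V) : Prop := ∃ v : V → Bool, Holds v Φ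

def tt : PropForm V := neg ff
def and (Φ Ψ : PropForm V) : PropForm V := neg (or (neg Φ) (neg Ψ))
def imp (Φ Ψ : PropForm V) : PropForm V := or (neg Φ) Ψ
def iff (Φ Ψ : PropForm V) : PropForm V := and (imp Φ Ψ) (imp Ψ Φ)

/-- The constant `[c]` for a condition `c` that does not depend on the variables. -/
def const (c : Prop) [Decidable c] : PropForm V := if c then tt else ff

/-- Finite conjunction of a list of formulas. -/
def all (L : List (PropForm V)) : PropForm V := L.foldr and tt

/-- Finite disjunction of a list of formulas. -/
def any (L : List (PropForm V)) : PropForm V := L.foldr or ff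

/-- `⋀_{i ∈ L} f i` -/
def bigAnd (L : List ι) (f : ι → PropForm V) : PropForm V := all (L.map f)

/-- `⋁_{i ∈ L} f i` -/
def bigOr (L : List ι) (f : ι → PropForm V) : PropForm V := any (L.map f)

end PropForm

/-! ### The variables of the encoding -/

/-- The labels of the nodes of a syntax DAG. -/
inductive Label (AP : Type*) where
  | prop (p : AP)
  | eps | neg | or | next | untl | trig | plus | comp | star
  deriving DecidableEq

/-- `x k lab`: node `k` has label `lab`; `l k m`, `r k m`: node `m` is the left, right child of
node `k`; `a k`: node `k` has the type of an atomic expression;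
`y w i k`: the suffix of `w` from `i` satisfies the formula at node `k`;
`z w i j k`: the infix `[i, j)` of `w` matches the regular expression at node `k`. -/
inductive Var (AP : Type*) where
  | x (k : ℕ) (lab : Label AP)
  | l (k m : ℕ)
  | r (k m : ℕ)
  | a (k : ℕ)
  | y (w : UPWord AP) (i k : ℕ)
  | z (w : UPWord AP) (i j k : ℕ)

noncomputable section Encoding

open PropForm

variable {AP : Type*} [Fintype AP] [DecidableEq AP]

abbrev x (k : ℕ) (lab : Label AP) : PropForm (Var AP) := .var (.x k lab)
abbrev l (k m : ℕ) : PropForm (Var AP) := .var (.l k m)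
abbrev r (k m : ℕ) : PropForm (Var AP) := .var (.r k m)
abbrev a (k : ℕ) : PropForm (Var AP) := .var (.a k)
abbrev y (w : UPWord AP) (i k : ℕ) : PropForm (Var AP) := .var (.y w i k)
abbrev z (w : UPWord AP) (i j k : ℕ) : PropForm (Var AP) := .var (.z w i j k)

/-- The atomic propositions, as a list. -/
def props (AP : Type*) [Fintype AP] : List AP := Finset.univ.toList

/-- Labels of atomic expressions. -/
def labA (AP : Type*) [Fintype AP] : List (Label AP) :=
  [.neg, .or] ++ (props AP).map .prop

/-- Labels of regular expressions. -/
def labR (AP : Type*) [Fintype AP] : List (Label AP) :=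
  [.eps, .plus, .comp, .star] ++ labA AP

/-- Labels of PSL formulas. -/
def labF (AP : Type*) [Fintype AP] : List (Label AP) :=
  [.next, .untl, .trig] ++ labA AP

/-- All labels. -/
def labAll (AP : Type*) [Fintype AP] : List (Label AP) :=
  [.next, .untl, .trig] ++ labR AP

/-- Node `k` carries a label from the list `L`. -/
def hasLab (L : List (Label AP)) (k : ℕ) : PropForm (Var AP) := bigOr L fun c => x k c

/-! #### Structural constraints -/

/-- Every node has exactly one label. -/
def strLabel (n : ℕ) : PropForm (Var AP) :=
  and (bigAnd (List.Ico 1 (n + 1)) fun k => bigOr (labAll AP) fun c => x k c)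
    (bigAnd (List.Ico 1 (n + 1)) fun k => bigAnd (labAll AP) fun c => bigAnd (labAll AP) fun d =>
      if c ≠ d then or (neg (x k c)) (neg (x k d)) else tt)

/-- Every node `k ≥ 2` has exactly one left child, and it is smaller than `k`. -/
def strLeft (n : ℕ) : PropForm (Var AP) :=
  and (bigAnd (List.Ico 2 (n + 1)) fun k => bigOr (List.Ico 1 k) fun m => l k m)
    (bigAnd (List.Ico 2 (n + 1)) fun k => bigAnd (List.Ico 1 k) fun m =>
      bigAnd (List.Ico (m + 1) k) fun m' => or (neg (l k m)) (neg (l k m')))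

/-- Every node `k ≥ 2` has exactly one right child, and it is smaller than `k`. -/
def strRight (n : ℕ) : PropForm (Var AP) :=
  and (bigAnd (List.Ico 2 (n + 1)) fun k => bigOr (List.Ico 1 k) fun m => r k m)
    (bigAnd (List.Ico 2 (n + 1)) fun k => bigAnd (List.Ico 1 k) fun m =>
      bigAnd (List.Ico (m + 1) k) fun m' => or (neg (r k m)) (neg (r k m')))

/-- Nodes `k ≥ 2` with a label in `L` have a left child with label in `LL` and a right child
with label in `LR`. -/
def strOrder (n : ℕ) (L LL LR : List (Label AP)) : PropForm (Var AP) :=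
  bigAnd (List.Ico 2 (n + 1)) fun k => bigAnd (List.Ico 1 k) fun m => bigAnd (List.Ico 1 k) fun m' =>
    bigAnd L fun c =>
      imp (and (x k c) (and (l k m) (r k m'))) (and (hasLab LL m) (hasLab LR m'))

/-- Typing of `¬` and `∨` inside regular expressions: where a regular expression is required,
a node with label `¬` or `∨` is of atomic type, and below a node of atomic type there are only
`¬`, `∨` and propositions. -/
def strAtomic (n : ℕ) : PropForm (Var AP) :=
  all [
    bigAnd (List.Ico 1 (n + 1)) fun k => imp (a k) (hasLab (labA AP) k),
    bigAnd (List.Ico 2 (n + 1)) fun k => bigAnd (List.Ico 1 k) fun m =>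
      bigAnd [Label.neg, Label.or] fun c => imp (and (a k) (and (x k c) (l k m))) (a m),
    bigAnd (List.Ico 2 (n + 1)) fun k => bigAnd (List.Ico 1 k) fun m =>
      imp (and (a k) (and (x k .or) (r k m))) (a m),
    bigAnd (List.Ico 2 (n + 1)) fun k => bigAnd (List.Ico 1 k) fun m =>
      bigAnd [Label.plus, Label.comp, Label.star, Label.trig] fun c =>
        imp (and (x k c) (l k m)) (imp (or (x m .neg) (x m .or)) (a m)),
    bigAnd (List.Ico 2 (n + 1)) fun k => bigAnd (List.Ico 1 k) fun m =>
      bigAnd [Label.plus, Label.comp] fun c =>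
        imp (and (x k c) (r k m)) (imp (or (x m .neg) (x m .or)) (a m))]

/-- Node `1` is a leaf, and the root `n` is a PSL formula. -/
def strEnds (n : ℕ) : PropForm (Var AP) :=
  and (or (x 1 .eps) (bigOr (props AP) fun p => x 1 (.prop p))) (hasLab (labF AP) n)

/-- `Φ_n^str` -/
def PhiStr (n : ℕ) : PropForm (Var AP) :=
  all [strLabel n, strLeft n, strRight n,
    strOrder n [.plus, .star, .comp] (labR AP) (labR AP),
    strOrder n [.next, .untl, .neg, .or] (labF AP) (labF AP),
    strOrder n [.trig] (labR AP) (labF AP),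
    strAtomic n, strEnds n]

/-! #### Constraints for regular expressions -/

/-- `⋀_{0 ≤ i ≤ j ≤ B} f i j` -/
def infixes (B : ℕ) (f : ℕ → ℕ → PropForm (Var AP)) : PropForm (Var AP) :=
  bigAnd (List.Ico 0 (B + 1)) fun i => bigAnd (List.Ico i (B + 1)) fun j => f i j

/-- `⋀_k [x_{k,c} → f k]` -/
def forLeaf (n : ℕ) (c : Label AP) (f : ℕ → PropForm (Var AP)) : PropForm (Var AP) :=
  bigAnd (List.Ico 1 (n + 1)) fun k => imp (x k c) (f k)

/-- `⋀_{k, m < k} [x_{k,c} ∧ l_{k,m} → f k m]` -/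
def forUn (n : ℕ) (c : Label AP) (f : ℕ → ℕ → PropForm (Var AP)) : PropForm (Var AP) :=
  bigAnd (List.Ico 1 (n + 1)) fun k => bigAnd (List.Ico 1 k) fun m =>
    imp (and (x k c) (l k m)) (f k m)

/-- `⋀_{k, m < k, m' < k} [x_{k,c} ∧ l_{k,m} ∧ r_{k,m'} → f k m m']` -/
def forBin (n : ℕ) (c : Label AP) (f : ℕ → ℕ → ℕ → PropForm (Var AP)) : PropForm (Var AP) :=
  bigAnd (List.Ico 1 (n + 1)) fun k => bigAnd (List.Ico 1 k) fun m => bigAnd (List.Ico 1 k) fun m' =>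
    imp (and (x k c) (and (l k m) (r k m'))) (f k m m')

/-- The constraints that fix the variables `z`; `B = |u v^b|`. -/
def PhiReg (n : ℕ) (w : UPWord AP) (B : ℕ) : PropForm (Var AP) :=
  all [
    forLeaf n .eps fun k => infixes B fun i j => iff (z w i j k) (const (i = j)),
    bigAnd (props AP) fun p => forLeaf n (.prop p) fun k => infixes B fun i j =>
      iff (z w i j k) (const (j = i + 1 ∧ p ∈ w.word i)),
    forUn n .neg fun k m => infixes B fun i j =>
      iff (z w i j k) (and (const (j = i + 1)) (neg (z w i j m))),
    forBin n .or fun k m m' => infixes B fun i j =>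
      iff (z w i j k) (or (z w i j m) (z w i j m')),
    forBin n .plus fun k m m' => infixes B fun i j =>
      iff (z w i j k) (or (z w i j m) (z w i j m')),
    forBin n .comp fun k m m' => infixes B fun i j =>
      iff (z w i j k) (bigOr (List.Ico i (j + 1)) fun t => and (z w i t m) (z w t j m')),
    forUn n .star fun k m => infixes B fun i j =>
      iff (z w i j k) (or (const (i = j))
        (bigOr (List.Ico (i + 1) (j + 1)) fun t => and (z w i t m) (z w t j k)))]

/-! #### Constraints for the LTL operators and the triggers operator -/

/-- The positions between `i` and `j` in the loop, where `|u| ≤ i, j < |uv|`. -/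
def between (w : UPWord AP) (i j : ℕ) : List ℕ :=
  if i ≤ j then List.Ico i j else List.Ico w.lu j ++ List.Ico i w.luv

/-- The constraints that fix the variables `y`; `B = |u v^b|`. -/
def PhiLTL (n : ℕ) (w : UPWord AP) (B : ℕ) : PropForm (Var AP) :=
  all [
    bigAnd (props AP) fun p => forLeaf n (.prop p) fun k => bigAnd (List.Ico 0 w.luv) fun i =>
      if p ∈ w.word i then y w i k else neg (y w i k),
    forUn n .neg fun k m => bigAnd (List.Ico 0 w.luv) fun i => iff (y w i k) (neg (y w i m)),
    forBin n .or fun k m m' => bigAnd (List.Ico 0 w.luv) fun i =>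
      iff (y w i k) (or (y w i m) (y w i m')),
    forUn n .next fun k m =>
      and (bigAnd (List.Ico 0 (w.luv - 1)) fun i => iff (y w i k) (y w (i + 1) m))
        (iff (y w (w.luv - 1) k) (y w w.lu m)),
    forBin n .untl fun k m m' =>
      and
        (bigAnd (List.Ico 0 w.lu) fun i => iff (y w i k)
          (bigOr (List.Ico i w.luv) fun j =>
            and (y w j m') (bigAnd (List.Ico i j) fun t => y w t m)))
        (bigAnd (List.Ico w.lu w.luv) fun i => iff (y w i k)
          (bigOr (List.Ico w.lu w.luv) fun j =>
            and (y w j m') (bigAnd (between w i j) fun t => y w t m))),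
    forBin n .trig fun k m m' => bigAnd (List.Ico 0 w.luv) fun i => iff (y w i k)
      (bigAnd (List.Ico (i + 1) (B + 1)) fun j => imp (z w i j m) (y w (w.M (j - 1)) m'))]

/-- `Φ_n^{u,v}`, with `b = 2^n + 1` unrollings of `v`. -/
def PhiWord (n : ℕ) (w : UPWord AP) : PropForm (Var AP) :=
  and (PhiReg n w (w.luvb (2 ^ n + 1))) (PhiLTL n w (w.luvb (2 ^ n + 1)))

/-- `Φ_n^cst` -/
def PhiCst (S : Sample AP) (n : ℕ) : PropForm (Var AP) :=
  and (bigAnd S.P.toList fun w => and (PhiWord n w) (y w 0 n))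
    (bigAnd S.N.toList fun w => and (PhiWord n w) (neg (y w 0 n)))

/-- `Φ_n^S` -/
def Phi (S : Sample AP) (n : ℕ) : PropForm (Var AP) := and (PhiStr n) (PhiCst S n)

end Encoding

/-! ### Extraction of a formula from a model -/

/-- `Unravels v k t`: the labels and children given by the interpretation `v` unravel, from node
`k` on, to the syntax tree `t`. -/
inductive Unravels {AP : Type*} (v : Var AP → Bool) : ℕ → SynTree AP → Prop where
  | prop {k : ℕ} {p : AP} (hx : v (.x k (.prop p))) : Unravels v k (.prop p)
  | eps {k : ℕ} (hx : v (.x k .eps)) : Unravels v k .eps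
  | neg {k m : ℕ} {t : SynTree AP} (hx : v (.x k .neg))
      (hm : 1 ≤ m ∧ m < k) (hl : v (.l k m)) (h : Unravels v m t) : Unravels v k (.neg t)
  | next {k m : ℕ} {t : SynTree AP} (hx : v (.x k .next))
      (hm : 1 ≤ m ∧ m < k) (hl : v (.l k m)) (h : Unravels v m t) : Unravels v k (.next t)
  | star {k m : ℕ} {t : SynTree AP} (hx : v (.x k .star))
      (hm : 1 ≤ m ∧ m < k) (hl : v (.l k m)) (h : Unravels v m t) : Unravels v k (.star t)
  | or {k m m' : ℕ} {t t' : SynTree AP} (hx : v (.x k .or))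
      (hm : 1 ≤ m ∧ m < k) (hl : v (.l k m)) (h : Unravels v m t)
      (hm' : 1 ≤ m' ∧ m' < k) (hr : v (.r k m')) (h' : Unravels v m' t') :
      Unravels v k (.or t t')
  | untl {k m m' : ℕ} {t t' : SynTree AP} (hx : v (.x k .untl))
      (hm : 1 ≤ m ∧ m < k) (hl : v (.l k m)) (h : Unravels v m t)
      (hm' : 1 ≤ m' ∧ m' < k) (hr : v (.r k m')) (h' : Unravels v m' t') :
      Unravels v k (.untl t t')
  | trig {k m m' : ℕ} {t t' : SynTree AP} (hx : v (.x k .trig))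
      (hm : 1 ≤ m ∧ m < k) (hl : v (.l k m)) (h : Unravels v m t)
      (hm' : 1 ≤ m' ∧ m' < k) (hr : v (.r k m')) (h' : Unravels v m' t') :
      Unravels v k (.trig t t')
  | plus {k m m' : ℕ} {t t' : SynTree AP} (hx : v (.x k .plus))
      (hm : 1 ≤ m ∧ m < k) (hl : v (.l k m)) (h : Unravels v m t)
      (hm' : 1 ≤ m' ∧ m' < k) (hr : v (.r k m')) (h' : Unravels v m' t') :
      Unravels v k (.plus t t')
  | comp {k m m' : ℕ} {t t' : SynTree AP} (hx : v (.x k .comp))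
      (hm : 1 ≤ m ∧ m < k) (hl : v (.l k m)) (h : Unravels v m t)
      (hm' : 1 ≤ m' ∧ m' < k) (hr : v (.r k m')) (h' : Unravels v m' t') :
      Unravels v k (.comp t t')

/-- `φ` is the formula `φ_v` that is read off the interpretation `v` at the root `n`. -/
def Extracts {AP : Type*} (v : Var AP → Bool) (n : ℕ) (φ : PSL AP) : Prop := Unravels v n φ.tree

/-! ### The learning algorithm -/

/-- Configurations: the loop with counter value `n`; the loop left with a model `v` of `Φ_n^S`;
the result `φ` returned. -/
inductive Config (AP : Type*) where
  | loop (n : ℕ)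
  | solved (n : ℕ) (v : Var AP → Bool)
  | returned (φ : PSL AP)

/-- One step of the algorithm: increment the counter, construct `Φ` for the new counter value and
check its satisfiability; if it is unsatisfiable, stay in the loop, otherwise leave the loop
with some model `v` and then return `φ_v`. -/
inductive Step {AP : Type*} [Fintype AP] [DecidableEq AP] (S : Sample AP) :
    Config AP → Config AP → Prop where
  | unsat {n : ℕ} (h : ¬ (Phi S (n + 1)).Satisfiable) : Step S (.loop n) (.loop (n + 1))
  | sat {n : ℕ} {v : Var AP → Bool} (h : (Phi S (n + 1)).Holds v) :
      Step S (.loop n) (.solved (n + 1) v)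
  | ret {n : ℕ} {v : Var AP → Bool} {φ : PSL AP} (h : Extracts v n φ) :
      Step S (.solved n v) (.returned φ)

/-- `c` occurs in a run of the algorithm on the input `S`. -/
def Reachable {AP : Type*} [Fintype AP] [DecidableEq AP] (S : Sample AP) (c : Config AP) : Prop :=
  Relation.ReflTransGen (Step S) (.loop 0) c

end PSLLearning

/-!
A model of `Φ_n^str` is a syntax DAG on the nodes `1, …, n`, and unravelling it from node `n` gives
a formula with at most `n` distinct subtrees. Going up the DAG, the remaining constraints force
`z_{i,j,k}` to say that the expression at node `k` matches the infix `[i, j)` of `uv^ω`, and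
`y_{i,k}` to say that the suffix from position `i` satisfies the formula at node `k`.

Finitely many positions suffice. For the temporal operators this is so because the suffixes of
`uv^ω` repeat with period `|v|` after `|u|`. For `ρ ↦ φ`, membership in the language of a regular
expression with `m` subexpressions depends only on one of at most `2 ^ m` states, so if a word
spanning more than `2 ^ n` copies of `v` matches `ρ`, then two of the boundaries between copies
meet the same state, and the copies between them can be cut out. The shorter match ends at an
equivalent position, so matches ending within `uv^b` are enough.

Conversely, numbering the distinct subtrees of a consistent formula by increasing size gives a
model of `Φ_n`, where `n` is the size of the formula. Some consistent formula exists, because two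
distinct words differ at some position in some proposition; and replacing `φ` by `φ ∨ φ` raises
the size by exactly one. Hence the first satisfiable `Φ_n` gives the minimal size.
-/

namespace PSLLearning

/-! ### Propositional connectives -/

namespace PropForm

variable {V ι : Type*} {v : V → Bool}

@[simp] theorem holds_var (x : V) : Holds v (.var x) ↔ v x := Iff.rfl

@[simp] theorem holds_ff : ¬ Holds v .ff := id

@[simp] theorem holds_neg (Φ : PropForm V) : Holds v (.neg Φ) ↔ ¬ Holds v Φ := Iff.rfl

@[simp] theorem holds_or (Φ Ψ : PropForm V) : Holds v (.or Φ Ψ) ↔ Holds v Φ ∨ Holds v Ψ := Iff.rfl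

@[simp] theorem holds_tt : Holds v .tt := id

@[simp] theorem holds_and (Φ Ψ : PropForm V) : Holds v (.and Φ Ψ) ↔ Holds v Φ ∧ Holds v Ψ := by
  simp [PropForm.and]

@[simp] theorem holds_imp (Φ Ψ : PropForm V) : Holds v (.imp Φ Ψ) ↔ (Holds v Φ → Holds v Ψ) := by
  simp [PropForm.imp, imp_iff_not_or]

@[simp] theorem holds_iff (Φ Ψ : PropForm V) : Holds v (.iff Φ Ψ) ↔ (Holds v Φ ↔ Holds v Ψ) := by
  simp [PropForm.iff, iff_def]

@[simp] theorem holds_const (c : Prop) [Decidable c] : Holds v (const c) ↔ c := by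
  by_cases h : c <;> simp [const, h]

@[simp] theorem holds_all (L : List (PropForm V)) : Holds v (all L) ↔ ∀ Φ ∈ L, Holds v Φ := by
  induction L with
  | nil => simp [all]
  | cons Φ L ih => exact (holds_and Φ (all L)).trans (by simp [ih])

@[simp] theorem holds_any (L : List (PropForm V)) : Holds v (any L) ↔ ∃ Φ ∈ L, Holds v Φ := by
  induction L with
  | nil => simp [any]
  | cons Φ L ih => exact (holds_or Φ (any L)).trans (by simp [ih])

@[simp] theorem holds_bigAnd (L : List ι) (f : ι → PropForm V) :
    Holds v (bigAnd L f) ↔ ∀ i ∈ L, Holds v (f i) := by simp [bigAnd]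

@[simp] theorem holds_bigOr (L : List ι) (f : ι → PropForm V) :
    Holds v (bigOr L f) ↔ ∃ i ∈ L, Holds v (f i) := by simp [bigOr]

@[simp] theorem holds_ite (c : Prop) [Decidable c] (Φ Ψ : PropForm V) :
    Holds v (if c then Φ else Ψ) ↔ if c then Holds v Φ else Holds v Ψ := by
  split <;> rfl

end PropForm

open PropForm

/-! ### Structural constraints -/

section Labels

variable {AP : Type*} [Fintype AP]

@[simp] theorem mem_props (p : AP) : p ∈ props AP := by simp [props]

theorem mem_labA {c : Label AP} : c ∈ labA AP ↔ c = .neg ∨ c = .or ∨ ∃ p, c = .prop p := by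
  simp [labA, eq_comm]

theorem mem_labR {c : Label AP} : c ∈ labR AP ↔
    c = .eps ∨ c = .plus ∨ c = .comp ∨ c = .star ∨ c = .neg ∨ c = .or ∨ ∃ p, c = .prop p := by
  simp [labR, mem_labA]

theorem mem_labF {c : Label AP} : c ∈ labF AP ↔
    c = .next ∨ c = .untl ∨ c = .trig ∨ c = .neg ∨ c = .or ∨ ∃ p, c = .prop p := by
  simp [labF, mem_labA]

@[simp] theorem mem_labAll (c : Label AP) : c ∈ labAll AP := by
  cases c <;> simp [labAll, mem_labR]

end Labels

/-- Node `m` is a left child of node `k` under the interpretation `v`. The variables `l k m` with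
`m = 0` or `m ≥ k` do not occur in the encoding, hence the bounds. -/
def IsLeft {AP : Type*} (v : Var AP → Bool) (k m : ℕ) : Prop := (1 ≤ m ∧ m < k) ∧ v (.l k m)

/-- Node `m` is a right child of node `k` under the interpretation `v`, with the bounds of
`IsLeft`. -/
def IsRight {AP : Type*} (v : Var AP → Bool) (k m : ℕ) : Prop := (1 ≤ m ∧ m < k) ∧ v (.r k m)

theorem IsLeft.two_le {AP : Type*} {v : Var AP → Bool} {k m : ℕ} (h : IsLeft v k m) : 2 ≤ k :=
  (Nat.succ_le_succ h.1.1).trans h.1.2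

theorem IsRight.two_le {AP : Type*} {v : Var AP → Bool} {k m : ℕ} (h : IsRight v k m) : 2 ≤ k :=
  (Nat.succ_le_succ h.1.1).trans h.1.2

/-- The interpretation `v` describes a well-typed syntax DAG on the nodes `1, …, n`: the
structural constraints `Φ_n^str`, as properties of `v`. -/
structure IsSyntaxDAG {AP : Type*} [Fintype AP] (v : Var AP → Bool) (n : ℕ) : Prop where
  exists_label {k} : 1 ≤ k → k ≤ n → ∃ c, v (.x k c)
  label_unique {k c d} : 1 ≤ k → k ≤ n → v (.x k c) → v (.x k d) → c = d
  exists_left {k} : 2 ≤ k → k ≤ n → ∃ m, IsLeft v k m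
  left_unique {k m m'} : k ≤ n → IsLeft v k m → IsLeft v k m' → m = m'
  exists_right {k} : 2 ≤ k → k ≤ n → ∃ m, IsRight v k m
  right_unique {k m m'} : k ≤ n → IsRight v k m → IsRight v k m' → m = m'
  children_reg {k m m' c} : k ≤ n → c = .plus ∨ c = .star ∨ c = .comp → v (.x k c) →
    IsLeft v k m → IsRight v k m' →
      (∃ d ∈ labR AP, v (.x m d)) ∧ ∃ d ∈ labR AP, v (.x m' d)
  children_form {k m m' c} : k ≤ n → c = .next ∨ c = .untl ∨ c = .neg ∨ c = .or →
    v (.x k c) → IsLeft v k m → IsRight v k m' →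
      (∃ d ∈ labF AP, v (.x m d)) ∧ ∃ d ∈ labF AP, v (.x m' d)
  children_trig {k m m'} : k ≤ n → v (.x k .trig) → IsLeft v k m → IsRight v k m' →
      (∃ d ∈ labR AP, v (.x m d)) ∧ ∃ d ∈ labF AP, v (.x m' d)
  atomic_label {k} : 1 ≤ k → k ≤ n → v (.a k) → ∃ c ∈ labA AP, v (.x k c)
  atomic_left {k m c} : k ≤ n → c = .neg ∨ c = .or → v (.a k) → v (.x k c) →
    IsLeft v k m → v (.a m)
  atomic_right {k m} : k ≤ n → v (.a k) → v (.x k .or) →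
    IsRight v k m → v (.a m)
  left_atomic {k m c d} : k ≤ n → c = .plus ∨ c = .comp ∨ c = .star ∨ c = .trig →
    v (.x k c) → IsLeft v k m → d = .neg ∨ d = .or → v (.x m d) → v (.a m)
  right_atomic {k m c d} : k ≤ n → c = .plus ∨ c = .comp →
    v (.x k c) → IsRight v k m → d = .neg ∨ d = .or → v (.x m d) → v (.a m)
  leaf_one : v (.x 1 .eps) ∨ ∃ p, v (.x 1 (.prop p))
  root_form : ∃ c ∈ labF AP, v (.x n c)

section StructuralConstraints

variable {AP : Type*} {v : Var AP → Bool}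

@[simp] theorem holds_hasLab (L : List (Label AP)) (k : ℕ) :
    (hasLab L k).Holds v ↔ ∃ c ∈ L, v (.x k c) := by
  simp [hasLab]

theorem holds_strLabel [Fintype AP] [DecidableEq AP] (n : ℕ) : (strLabel n).Holds v ↔
    (∀ k, 1 ≤ k → k ≤ n → ∃ c, v (.x k c)) ∧
      ∀ k c d, 1 ≤ k → k ≤ n → v (.x k c) → v (.x k d) → c = d := by
  simp only [strLabel, holds_and, holds_bigAnd, holds_bigOr, List.Ico.mem, mem_labAll, true_and,
    holds_var, holds_ite, holds_or, holds_neg, holds_tt, true_imp_iff, Nat.lt_succ_iff, and_imp]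
  grind

/-- The constraints `strLeft` and `strRight` have the same shape, with `e` in place of `l`
and `r`. -/
theorem holds_unique_child_iff (n : ℕ) (e : ℕ → ℕ → PropForm (Var AP)) :
    (PropForm.and (bigAnd (List.Ico 2 (n + 1)) fun k => bigOr (List.Ico 1 k) fun m => e k m)
      (bigAnd (List.Ico 2 (n + 1)) fun k => bigAnd (List.Ico 1 k) fun m =>
        bigAnd (List.Ico (m + 1) k) fun m' => .or (.neg (e k m)) (.neg (e k m')))).Holds v ↔
    (∀ k, 2 ≤ k → k ≤ n → ∃ m, (1 ≤ m ∧ m < k) ∧ (e k m).Holds v) ∧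
      ∀ k m m', k ≤ n → (1 ≤ m ∧ m < k) ∧ (e k m).Holds v →
        (1 ≤ m' ∧ m' < k) ∧ (e k m').Holds v → m = m' := by
  simp only [holds_and, holds_bigAnd, holds_bigOr, List.Ico.mem, holds_or, holds_neg,
    Nat.lt_succ_iff, and_imp]
  refine and_congr_right fun _ => ⟨fun h k m m' hkn h1 hk hm h1' hk' hm' => ?_,
    fun h k _ hkn m h1 hk m' hlt hk' => ?_⟩
  · rcases lt_trichotomy m m' with hlt | heq | hlt
    · exact absurd (h k (by omega) hkn m h1 hk m' hlt hk') (by tauto)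
    · exact heq
    · exact absurd (h k (by omega) hkn m' h1' hk' m hlt hk) (by tauto)
  · by_contra! hm
    exact absurd (h k m m' hkn h1 hk hm.1 (by omega) hk' hm.2) (by omega)

theorem holds_strLeft (n : ℕ) : (strLeft n).Holds v ↔
    (∀ k, 2 ≤ k → k ≤ n → ∃ m, IsLeft v k m) ∧
      ∀ k m m', k ≤ n → IsLeft v k m → IsLeft v k m' → m = m' :=
  holds_unique_child_iff n l

theorem holds_strRight (n : ℕ) : (strRight n).Holds v ↔
    (∀ k, 2 ≤ k → k ≤ n → ∃ m, IsRight v k m) ∧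
      ∀ k m m', k ≤ n → IsRight v k m → IsRight v k m' → m = m' :=
  holds_unique_child_iff n r

theorem holds_strOrder (n : ℕ) (L LL LR : List (Label AP)) :
    (strOrder n L LL LR).Holds v ↔ ∀ k m m' c, k ≤ n → c ∈ L → v (.x k c) →
      IsLeft v k m → IsRight v k m' →
        (∃ d ∈ LL, v (.x m d)) ∧ ∃ d ∈ LR, v (.x m' d) := by
  simp only [strOrder, holds_bigAnd, List.Ico.mem, holds_imp, holds_and, holds_var, holds_hasLab]
  exact ⟨fun h k m m' c hk hc hx hl hr =>
      h k (by have := hl.1; omega) m hl.1 m' hr.1 c hc ⟨hx, hl.2, hr.2⟩,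
    fun h k hk m hm m' hm' c hc hx => h k m m' c (by omega) hc hx.1 ⟨hm, hx.2.1⟩ ⟨hm', hx.2.2⟩⟩

theorem holds_strAtomic [Fintype AP] (n : ℕ) : (strAtomic n).Holds v ↔
    (∀ k, 1 ≤ k → k ≤ n → v (.a k) → ∃ c ∈ labA AP, v (.x k c)) ∧
    (∀ k m c, k ≤ n → c = .neg ∨ c = .or → v (.a k) → v (.x k c) →
      IsLeft v k m → v (.a m)) ∧
    (∀ k m, k ≤ n → v (.a k) → v (.x k .or) → IsRight v k m → v (.a m)) ∧
    (∀ k m c d, k ≤ n → c = .plus ∨ c = .comp ∨ c = .star ∨ c = .trig → v (.x k c) →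
      IsLeft v k m → d = .neg ∨ d = .or → v (.x m d) → v (.a m)) ∧
    ∀ k m c d, k ≤ n → c = .plus ∨ c = .comp → v (.x k c) →
      IsRight v k m → d = .neg ∨ d = .or → v (.x m d) → v (.a m) := by
  simp only [strAtomic, holds_all, List.forall_mem_cons, List.not_mem_nil, false_imp_iff,
    implies_true, and_true]
  simp only [holds_bigAnd, List.Ico.mem, holds_imp, holds_and, holds_var, holds_hasLab, holds_or,
    List.mem_cons, List.not_mem_nil, or_false, Nat.lt_succ_iff, IsLeft, IsRight]
  refine and_congr ?_ (and_congr ?_ (and_congr ?_ (and_congr ?_ ?_))) <;> grind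

theorem holds_strEnds [Fintype AP] (n : ℕ) : (strEnds n).Holds v ↔
    (v (.x 1 .eps) ∨ ∃ p, v (.x 1 (.prop p))) ∧
      ∃ c ∈ labF AP, v (.x n c) := by
  simp [strEnds]

theorem holds_PhiStr [Fintype AP] [DecidableEq AP] (n : ℕ) :
    (PhiStr n).Holds v ↔ IsSyntaxDAG v n := by
  simp only [PhiStr, holds_all, List.forall_mem_cons, List.not_mem_nil, false_imp_iff,
    implies_true, and_true]
  simp only [holds_strLabel, holds_strLeft, holds_strRight, holds_strOrder, holds_strAtomic,
    holds_strEnds, List.mem_cons, List.not_mem_nil, or_false]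
  constructor
  · rintro ⟨⟨hx, hx'⟩, ⟨hl, hl'⟩, ⟨hr, hr'⟩, hreg, hform, htrig,
      ⟨ha, hal, har, hla, hra⟩, hleaf, hroot⟩
    exact ⟨@hx, @hx', @hl, @hl', @hr, @hr', @hreg, @hform, fun hk => htrig _ _ _ _ hk rfl, @ha,
      @hal, @har, @hla, @hra, hleaf, hroot⟩
  · intro h
    exact ⟨⟨@h.exists_label, @h.label_unique⟩, ⟨@h.exists_left, @h.left_unique⟩,
      ⟨@h.exists_right, @h.right_unique⟩, @h.children_reg, @h.children_form,
      fun _ _ _ _ hk hc => hc ▸ h.children_trig hk,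
      ⟨@h.atomic_label, @h.atomic_left, @h.atomic_right, @h.left_atomic, @h.right_atomic⟩,
      h.leaf_one, h.root_form⟩

end StructuralConstraints

/-! ### Constraints for the sample words -/

/-- The variables `z` satisfy, for the word `w` and its infixes within `[0, B]`, the recursion
equations of the matching relation: the constraints `PhiReg`, as properties of `v`. -/
structure IsMatchTable {AP : Type*} (v : Var AP → Bool) (n : ℕ) (w : UPWord AP) (B : ℕ) :
    Prop where
  eps {k i j} : 1 ≤ k → k ≤ n → v (.x k .eps) → i ≤ j → j ≤ B → (v (.z w i j k) ↔ i = j)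
  prop {p k i j} : 1 ≤ k → k ≤ n → v (.x k (.prop p)) → i ≤ j → j ≤ B →
    (v (.z w i j k) ↔ j = i + 1 ∧ p ∈ w.word i)
  neg {k m i j} : k ≤ n → v (.x k .neg) → IsLeft v k m → i ≤ j → j ≤ B →
    (v (.z w i j k) ↔ j = i + 1 ∧ ¬ v (.z w i j m))
  or {k m m' i j} : k ≤ n → v (.x k .or) → IsLeft v k m → IsRight v k m' → i ≤ j → j ≤ B →
    (v (.z w i j k) ↔ v (.z w i j m) ∨ v (.z w i j m'))
  plus {k m m' i j} : k ≤ n → v (.x k .plus) → IsLeft v k m → IsRight v k m' → i ≤ j → j ≤ B →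
    (v (.z w i j k) ↔ v (.z w i j m) ∨ v (.z w i j m'))
  comp {k m m' i j} : k ≤ n → v (.x k .comp) → IsLeft v k m → IsRight v k m' → i ≤ j → j ≤ B →
    (v (.z w i j k) ↔ ∃ t, (i ≤ t ∧ t ≤ j) ∧ v (.z w i t m) ∧ v (.z w t j m'))
  star {k m i j} : k ≤ n → v (.x k .star) → IsLeft v k m → i ≤ j → j ≤ B →
    (v (.z w i j k) ↔ i = j ∨ ∃ t, (i < t ∧ t ≤ j) ∧ v (.z w i t m) ∧ v (.z w t j k))

/-- The variables `y` satisfy, for the word `w` and its positions in `uv`, the recursion equations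
of the satisfaction relation: the constraints `PhiLTL`, as properties of `v`. -/
structure IsSatTable {AP : Type*} (v : Var AP → Bool) (n : ℕ) (w : UPWord AP) (B : ℕ) :
    Prop where
  prop {p k i} : 1 ≤ k → k ≤ n → v (.x k (.prop p)) → i < w.luv → (v (.y w i k) ↔ p ∈ w.word i)
  neg {k m i} : k ≤ n → v (.x k .neg) → IsLeft v k m → i < w.luv →
    (v (.y w i k) ↔ ¬ v (.y w i m))
  or {k m m' i} : k ≤ n → v (.x k .or) → IsLeft v k m → IsRight v k m' → i < w.luv →
    (v (.y w i k) ↔ v (.y w i m) ∨ v (.y w i m'))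
  next {k m i} : k ≤ n → v (.x k .next) → IsLeft v k m → i < w.luv - 1 →
    (v (.y w i k) ↔ v (.y w (i + 1) m))
  next_last {k m} : k ≤ n → v (.x k .next) → IsLeft v k m →
    (v (.y w (w.luv - 1) k) ↔ v (.y w w.lu m))
  untl_of_lt {k m m' i} : k ≤ n → v (.x k .untl) → IsLeft v k m → IsRight v k m' → i < w.lu →
    (v (.y w i k) ↔
      ∃ j, (i ≤ j ∧ j < w.luv) ∧ v (.y w j m') ∧ ∀ t, i ≤ t ∧ t < j → v (.y w t m))
  untl_of_ge {k m m' i} : k ≤ n → v (.x k .untl) → IsLeft v k m → IsRight v k m' →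
    w.lu ≤ i → i < w.luv →
    (v (.y w i k) ↔
      ∃ j, (w.lu ≤ j ∧ j < w.luv) ∧ v (.y w j m') ∧ ∀ t ∈ between w i j, v (.y w t m))
  trig {k m m' i} : k ≤ n → v (.x k .trig) → IsLeft v k m → IsRight v k m' → i < w.luv →
    (v (.y w i k) ↔ ∀ j, i < j ∧ j ≤ B → v (.z w i j m) → v (.y w (w.M (j - 1)) m'))

section WordConstraints

variable {AP : Type*} {v : Var AP → Bool}

@[simp] theorem holds_infixes (B : ℕ) (f : ℕ → ℕ → PropForm (Var AP)) :
    (infixes B f).Holds v ↔ ∀ i j, i ≤ j → j ≤ B → (f i j).Holds v := by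
  simp only [infixes, holds_bigAnd, List.Ico.mem]
  exact ⟨fun h i j hij hj => h i (by omega) j (by omega), fun h i _ j hj => h i j hj.1 (by omega)⟩

@[simp] theorem holds_forLeaf (n : ℕ) (c : Label AP) (f : ℕ → PropForm (Var AP)) :
    (forLeaf n c f).Holds v ↔ ∀ k, 1 ≤ k → k ≤ n → v (.x k c) → (f k).Holds v := by
  simp [forLeaf]

@[simp] theorem holds_forUn (n : ℕ) (c : Label AP) (f : ℕ → ℕ → PropForm (Var AP)) :
    (forUn n c f).Holds v ↔
      ∀ k m, k ≤ n → v (.x k c) → IsLeft v k m → (f k m).Holds v := by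
  simp only [forUn, holds_bigAnd, List.Ico.mem, holds_imp, holds_and, holds_var]
  exact ⟨fun h k m hk hx hl => h k (by have := hl.1; omega) m hl.1 ⟨hx, hl.2⟩,
    fun h k hk m hm hx => h k m (by omega) hx.1 ⟨hm, hx.2⟩⟩

@[simp] theorem holds_forBin (n : ℕ) (c : Label AP) (f : ℕ → ℕ → ℕ → PropForm (Var AP)) :
    (forBin n c f).Holds v ↔
      ∀ k m m', k ≤ n → v (.x k c) → IsLeft v k m → IsRight v k m' → (f k m m').Holds v := by
  simp only [forBin, holds_bigAnd, List.Ico.mem, holds_imp, holds_and, holds_var]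
  exact ⟨fun h k m m' hk hx hl hr =>
      h k (by have := hl.1; omega) m hl.1 m' hr.1 ⟨hx, hl.2, hr.2⟩,
    fun h k hk m hm m' hm' hx => h k m m' (by omega) hx.1 ⟨hm, hx.2.1⟩ ⟨hm', hx.2.2⟩⟩

variable [Fintype AP] [DecidableEq AP]

theorem holds_PhiReg (n : ℕ) (w : UPWord AP) (B : ℕ) :
    (PhiReg n w B).Holds v ↔ IsMatchTable v n w B := by
  simp only [PhiReg, holds_all, List.forall_mem_cons, List.not_mem_nil, false_imp_iff,
    implies_true, and_true, holds_bigAnd, holds_bigOr, List.Ico.mem, holds_and, holds_var,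
    holds_or, holds_neg, holds_forLeaf, holds_forUn, holds_forBin, holds_infixes, holds_iff,
    holds_const, mem_props, true_imp_iff, Nat.lt_succ_iff, Nat.succ_le_iff]
  constructor
  · rintro ⟨heps, hprop, hneg, hor, hplus, hcomp, hstar⟩
    exact ⟨fun h1 hk hx => heps _ h1 hk hx _ _, fun h1 hk hx => hprop _ _ h1 hk hx _ _,
      fun hk hx hl => hneg _ _ hk hx hl _ _, fun hk hx hl hr => hor _ _ _ hk hx hl hr _ _,
      fun hk hx hl hr => hplus _ _ _ hk hx hl hr _ _,
      fun hk hx hl hr => hcomp _ _ _ hk hx hl hr _ _, fun hk hx hl => hstar _ _ hk hx hl _ _⟩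
  · intro h
    exact ⟨fun _ h1 hk hx _ _ => h.eps h1 hk hx, fun _ _ h1 hk hx _ _ => h.prop h1 hk hx,
      fun _ _ hk hx hl _ _ => h.neg hk hx hl, fun _ _ _ hk hx hl hr _ _ => h.or hk hx hl hr,
      fun _ _ _ hk hx hl hr _ _ => h.plus hk hx hl hr,
      fun _ _ _ hk hx hl hr _ _ => h.comp hk hx hl hr, fun _ _ hk hx hl _ _ => h.star hk hx hl⟩

theorem holds_PhiLTL (n : ℕ) (w : UPWord AP) (B : ℕ) :
    (PhiLTL n w B).Holds v ↔ IsSatTable v n w B := by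
  simp only [PhiLTL, holds_all, List.forall_mem_cons, List.not_mem_nil, false_imp_iff,
    implies_true, and_true, holds_bigAnd, holds_bigOr, List.Ico.mem, holds_and, holds_var,
    holds_or, holds_neg, holds_forLeaf, holds_forUn, holds_forBin, holds_iff, holds_imp, mem_props,
    true_imp_iff, holds_ite, zero_le, true_and, Nat.lt_succ_iff, Nat.succ_le_iff, ite_prop_iff_and]
  constructor
  · rintro ⟨hprop, hneg, hor, hnext, huntl, htrig⟩
    exact ⟨fun h1 hk hx hi => ⟨fun hy => by_contra fun hp => (hprop _ _ h1 hk hx _ hi).2 hp hy,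
        (hprop _ _ h1 hk hx _ hi).1⟩,
      fun hk hx hl => hneg _ _ hk hx hl _, fun hk hx hl hr => hor _ _ _ hk hx hl hr _,
      fun hk hx hl => (hnext _ _ hk hx hl).1 _, fun hk hx hl => (hnext _ _ hk hx hl).2,
      fun hk hx hl hr => (huntl _ _ _ hk hx hl hr).1 _,
      fun hk hx hl hr h1 h2 => (huntl _ _ _ hk hx hl hr).2 _ ⟨h1, h2⟩,
      fun hk hx hl hr => htrig _ _ _ hk hx hl hr _⟩
  · intro h
    exact ⟨fun _ _ h1 hk hx _ hi => ⟨(h.prop h1 hk hx hi).2, mt (h.prop h1 hk hx hi).1⟩,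
      fun _ _ hk hx hl _ => h.neg hk hx hl, fun _ _ _ hk hx hl hr _ => h.or hk hx hl hr,
      fun _ _ hk hx hl => ⟨fun _ => h.next hk hx hl, h.next_last hk hx hl⟩,
      fun _ _ _ hk hx hl hr => ⟨fun _ => h.untl_of_lt hk hx hl hr,
        fun _ hi => h.untl_of_ge hk hx hl hr hi.1 hi.2⟩,
      fun _ _ _ hk hx hl hr _ => h.trig hk hx hl hr⟩

end WordConstraints

/-! ### Slices of infinite words -/

section Slices

open scoped Computability

variable {A : Type*} {α : ℕ → A} {L M : Language A} {i j : ℕ}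

/-- The infix `α[i, j)` of an infinite word, as a list; it is empty for `j ≤ i`. -/
def slice (α : ℕ → A) (i j : ℕ) : List A := (List.Ico i j).map α

theorem length_slice (α : ℕ → A) (i j : ℕ) : (slice α i j).length = j - i := by simp [slice]

@[simp] theorem slice_succ (α : ℕ → A) (i : ℕ) : slice α i (i + 1) = [α i] := by simp [slice]

theorem slice_append {k : ℕ} (hik : i ≤ k) (hkj : k ≤ j) :
    slice α i k ++ slice α k j = slice α i j := by
  rw [slice, slice, ← List.map_append, List.Ico.append_consecutive hik hkj, slice]

theorem slice_add {β : ℕ → A} {d e : ℕ} (h : ∀ k, i ≤ k → k < j → α (k + d) = β (k + e)) :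
    slice α (i + d) (j + d) = slice β (i + e) (j + e) := by
  rw [slice, slice, ← List.Ico.map_add, ← List.Ico.map_add, List.map_map, List.map_map]
  refine List.map_congr_left fun k hk => ?_
  simpa only [Function.comp_apply, add_comm] using h k (List.Ico.mem.1 hk).1 (List.Ico.mem.1 hk).2

theorem append_eq_slice (hij : i ≤ j) {x y : List A} :
    x ++ y = slice α i j ↔ ∃ k, (i ≤ k ∧ k ≤ j) ∧ x = slice α i k ∧ y = slice α k j := by
  constructor
  · intro h
    have hlen := congrArg List.length h
    rw [List.length_append, length_slice] at hlen
    have hk : i + x.length ≤ j := by omega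
    rw [← slice_append (Nat.le_add_right i x.length) hk] at h
    exact ⟨_, ⟨Nat.le_add_right _ _, hk⟩, List.append_inj h (by simp [length_slice])⟩
  · rintro ⟨k, hk, rfl, rfl⟩
    exact slice_append hk.1 hk.2

theorem slice_eq_nil (hij : i ≤ j) : slice α i j = [] ↔ i = j := by
  rw [← List.length_eq_zero_iff, length_slice]
  omega

theorem slice_mem_mul (hij : i ≤ j) : slice α i j ∈ L * M ↔
    ∃ k, (i ≤ k ∧ k ≤ j) ∧ slice α i k ∈ L ∧ slice α k j ∈ M := by
  simp only [Language.mem_mul, append_eq_slice hij]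
  exact ⟨fun ⟨_, hx, _, hy, k, hk, ex, ey⟩ => ⟨k, hk, ex ▸ hx, ey ▸ hy⟩,
    fun ⟨k, hk, hx, hy⟩ => ⟨_, hx, _, hy, k, hk, rfl, rfl⟩⟩

theorem append_mem_kstar {x y : List A} (hx : x ∈ L) (hy : y ∈ L∗) : x ++ y ∈ L∗ :=
  (mul_kstar_le_kstar : L * L∗ ≤ L∗) (Language.append_mem_mul hx hy)

theorem mem_kstar_iff_eq_nil_or {x : List A} :
    x ∈ L∗ ↔ x = [] ∨ ∃ a ∈ L, a ≠ [] ∧ ∃ b ∈ L∗, a ++ b = x := by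
  constructor
  · intro h
    obtain ⟨S, rfl, hS⟩ := Language.mem_kstar_iff_exists_nonempty.1 h
    cases S with
    | nil => exact .inl rfl
    | cons a S =>
      have ha := hS a List.mem_cons_self
      exact .inr ⟨a, ha.1, ha.2, _,
        Language.join_mem_kstar fun y hy => (hS y (List.mem_cons_of_mem a hy)).1, rfl⟩
  · rintro (rfl | ⟨a, ha, -, b, hb, rfl⟩)
    · exact Language.nil_mem_kstar L
    · exact append_mem_kstar ha hb

theorem slice_mem_kstar (hij : i ≤ j) : slice α i j ∈ L∗ ↔
    i = j ∨ ∃ k, (i < k ∧ k ≤ j) ∧ slice α i k ∈ L ∧ slice α k j ∈ L∗ := by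
  rw [mem_kstar_iff_eq_nil_or, slice_eq_nil hij]
  simp only [append_eq_slice hij]
  refine or_congr_right ⟨?_, ?_⟩
  · rintro ⟨_, ha, hne, _, hb, k, hk, rfl, rfl⟩
    rw [Ne, slice_eq_nil hk.1] at hne
    exact ⟨k, by omega, ha, hb⟩
  · rintro ⟨k, hk, ha, hb⟩
    exact ⟨_, ha, by rw [Ne, slice_eq_nil hk.1.le]; omega, _, hb, k, by omega, rfl, rfl⟩

/-! ### Factorizations of languages -/

/-- Membership in `L` can be tested at any nonempty prefix `x` through one of at most `N` states
`q`: the prefixes that may lead to `q` and the suffixes accepted from `q` form languages `Pre q`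
and `Post q`. A nondeterministic automaton with `N` states that are reached by a nonempty word
gives such a factorization; the notion is used to pump words down. -/
def HasFactorization (L : Language A) (N : ℕ) : Prop :=
  ∃ (Q : Type) (_ : Fintype Q) (Pre Post : Q → Language A), Fintype.card Q ≤ N ∧
    ∀ x y, x ≠ [] → (x ++ y ∈ L ↔ ∃ q, x ∈ Pre q ∧ y ∈ Post q)

namespace HasFactorization

variable {N N₁ N₂ : ℕ}

theorem mono (h : HasFactorization L N₁) (hN : N₁ ≤ N₂) : HasFactorization L N₂ :=
  let ⟨Q, _, Pre, Post, hQ, hL⟩ := h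
  ⟨Q, _, Pre, Post, hQ.trans hN, hL⟩

theorem of_le_one (hL : L ≤ 1) : HasFactorization L 0 := by
  refine ⟨Empty, inferInstance, nofun, nofun, by simp, fun x y hx => ?_⟩
  have : x ++ y ∉ L := fun h => hx (List.append_eq_nil_iff.1 ((Language.mem_one _).1 (hL h))).1
  simp [this]

theorem of_length_eq_one (hL : ∀ x ∈ L, x.length = 1) : HasFactorization L 1 := by
  refine ⟨Unit, inferInstance, fun _ => L, fun _ => 1, by simp, fun x y hx => ?_⟩
  simp only [Language.mem_one, exists_const]
  constructor
  · intro h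
    have hlen := hL _ h
    rw [List.length_append] at hlen
    have hpos := List.length_pos_iff.2 hx
    obtain rfl : y = [] := List.length_eq_zero_iff.1 (by omega)
    exact ⟨by simpa using h, rfl⟩
  · rintro ⟨h, rfl⟩
    simpa using h

theorem add (h₁ : HasFactorization L N₁) (h₂ : HasFactorization M N₂) :
    HasFactorization (L + M) (N₁ + N₂) := by
  obtain ⟨Q₁, _, Pre₁, Post₁, hQ₁, hL⟩ := h₁
  obtain ⟨Q₂, _, Pre₂, Post₂, hQ₂, hM⟩ := h₂
  refine ⟨Q₁ ⊕ Q₂, inferInstance, Sum.elim Pre₁ Pre₂, Sum.elim Post₁ Post₂,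
    by simpa using Nat.add_le_add hQ₁ hQ₂, fun x y hx => ?_⟩
  rw [Language.mem_add, hL x y hx, hM x y hx]
  simp only [Sum.exists, Sum.elim_inl, Sum.elim_inr]

/-- The cut falls either into the factor from `L`, leaving all of the factor from `M` to the
suffix, or properly into the factor from `M`. -/
theorem mul (h₁ : HasFactorization L N₁) (h₂ : HasFactorization M N₂) :
    HasFactorization (L * M) (N₁ + N₂) := by
  obtain ⟨Q₁, _, Pre₁, Post₁, hQ₁, hL⟩ := h₁
  obtain ⟨Q₂, _, Pre₂, Post₂, hQ₂, hM⟩ := h₂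
  refine ⟨Q₁ ⊕ Q₂, inferInstance, Sum.elim Pre₁ fun q => L * (Pre₂ q ⊓ {c | c ≠ []}),
    Sum.elim (fun q => Post₁ q * M) Post₂, by simpa using Nat.add_le_add hQ₁ hQ₂,
    fun x y hx => ?_⟩
  simp only [Sum.exists, Sum.elim_inl, Sum.elim_inr]
  constructor
  · rintro ⟨a, ha, b, hb, hab⟩
    rcases List.append_eq_append_iff.1 hab with ⟨c, rfl, rfl⟩ | ⟨c, rfl, rfl⟩
    · by_cases hc : c = []
      · subst hc
        obtain ⟨q, hq, hq'⟩ := (hL a [] (by simpa using hx)).1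
          (by rwa [List.append_nil])
        exact .inl ⟨q, by rwa [List.append_nil], Language.append_mem_mul hq' hb⟩
      · obtain ⟨q, hq, hq'⟩ := (hM c y hc).1 hb
        exact .inr ⟨q, Language.append_mem_mul ha ⟨hq, hc⟩, hq'⟩
    · obtain ⟨q, hq, hq'⟩ := (hL x c hx).1 ha
      exact .inl ⟨q, hq, Language.append_mem_mul hq' hb⟩
  · rintro (⟨q, hq, c, hc, b, hb, rfl⟩ | ⟨q, ⟨a, ha, c, ⟨hc, hne⟩, rfl⟩, hq⟩)
    · exact ⟨x ++ c, (hL x c hx).2 ⟨q, hq, hc⟩, b, hb, List.append_assoc _ _ _⟩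
    · exact ⟨a, ha, c ++ y, (hM c y hne).2 ⟨q, hc, hq⟩, (List.append_assoc _ _ _).symm⟩

/-- The states are those of `L`: the cut falls into one of the factors from `L`. -/
theorem kstar (h : HasFactorization L N) : HasFactorization L∗ N := by
  obtain ⟨Q, _, Pre, Post, hQ, hL⟩ := h
  refine ⟨Q, inferInstance, fun q => L∗ * (Pre q ⊓ {c | c ≠ []}), fun q => Post q * L∗, hQ,
    fun x y hx => ⟨fun h => ?_, ?_⟩⟩
  · obtain ⟨S, hS, hSL⟩ := Language.mem_kstar.1 h
    clear h
    induction S generalizing x with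
    | nil => simp_all
    | cons a S ih =>
      have ha := hSL a List.mem_cons_self
      have hS' : ∀ b ∈ S, b ∈ L := fun b hb => hSL b (List.mem_cons_of_mem a hb)
      have cut_in_head : ∀ c, a = x ++ c → y = c ++ S.flatten →
          ∃ q, x ∈ L∗ * (Pre q ⊓ {c | c ≠ []}) ∧ y ∈ Post q * L∗ := by
        rintro c rfl rfl
        obtain ⟨q, hq, hq'⟩ := (hL x c hx).1 ha
        exact ⟨q, ⟨[], Language.nil_mem_kstar L, x, ⟨hq, hx⟩, rfl⟩,
          Language.append_mem_mul hq' (Language.join_mem_kstar hS')⟩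
      rcases List.append_eq_append_iff.1 hS with ⟨c, ex, ey⟩ | ⟨c, rfl, hc⟩
      · exact cut_in_head c ex ey
      · rcases eq_or_ne c [] with rfl | hne
        · exact cut_in_head [] (by simp) (by simpa using hc.symm)
        · obtain ⟨q, ⟨b, hb, d, hd, rfl⟩, hy⟩ := ih c hne hc.symm hS'
          exact ⟨q, ⟨a ++ b, append_mem_kstar ha hb, d, hd,
            List.append_assoc _ _ _⟩, hy⟩
  · rintro ⟨q, ⟨a, ha, c, ⟨hc, hne⟩, rfl⟩, d, hd, b, hb, rfl⟩
    have hcd : c ++ d ∈ L := (hL c d hne).2 ⟨q, hc, hd⟩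
    rw [← kstar_mul_kstar L]
    refine ⟨a, ha, c ++ d ++ b, append_mem_kstar hcd hb, ?_⟩
    simp only [List.append_assoc]

/-- By pigeonhole, two of the `N + 1` cuts at `p, p + d, …, p + N * d` have the same state, and
the infix between them can be removed. -/
theorem exists_shorter_slice (h : HasFactorization L N) {p d : ℕ}
    (hα : ∀ e k, p ≤ k → α (k + e * d) = α k) (hip : i < p) (hpj : p + N * d ≤ j)
    (hij : slice α i j ∈ L) :
    ∃ e, 0 < e ∧ e ≤ N ∧ slice α i (j - e * d) ∈ L := by
  obtain ⟨Q, _, Pre, Post, hQ, hL⟩ := h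
  have cut_le : ∀ s : Fin (N + 1), p + s * d ≤ j := fun s =>
    (Nat.add_le_add_left (Nat.mul_le_mul_right d (Nat.le_of_lt_succ s.2)) p).trans hpj
  have slice_ne_nil : ∀ s, slice α i (p + s * d) ≠ [] := fun s => by
    rw [Ne, slice_eq_nil (by omega)]
    omega
  have exists_state : ∀ s : Fin (N + 1), ∃ q, slice α i (p + s * d) ∈ Pre q ∧
      slice α (p + s * d) j ∈ Post q := fun s =>
    (hL _ _ (slice_ne_nil s)).1 (by rwa [slice_append (by omega) (cut_le s)])
  choose q hpre hpost using exists_state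
  obtain ⟨s, s', hne, hq⟩ := Fintype.exists_ne_map_eq_of_card_lt q (by simpa using by omega)
  wlog hlt : s < s' generalizing s s'
  · exact this s' s hne.symm hq.symm (lt_of_le_of_ne (not_lt.1 hlt) hne.symm)
  have : (s : ℕ) < s' := hlt
  obtain ⟨e, he⟩ : ∃ e, (s' : ℕ) = s + e := ⟨s' - s, by omega⟩
  have hle := cut_le s'
  have hpost' := hpost s'
  rw [he, add_mul, ← add_assoc] at hpost' hle
  refine ⟨e, by omega, by omega, ?_⟩
  have hshift : slice α (p + s * d) (j - e * d) = slice α (p + s * d + e * d) j := by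
    conv_rhs => rw [← Nat.sub_add_cancel (show e * d ≤ j by omega)]
    exact (slice_add (e := 0) fun k hk _ => hα e k ((Nat.le_add_right _ _).trans hk)).symm
  rw [← slice_append (k := p + s * d) (by omega) (by omega)]
  exact (hL _ _ (slice_ne_nil s)).2 ⟨q s, hpre s, by rwa [hshift, hq]⟩

end HasFactorization

end Slices

/-! ### Semantics of syntax trees -/

namespace InfWord

variable {AP : Type*} (α : InfWord AP)

theorem suffix_zero : α.suffix 0 = α := funext fun j => congrArg α (Nat.zero_add j)

theorem suffix_suffix (i j : ℕ) : (α.suffix i).suffix j = α.suffix (i + j) :=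
  funext fun k => congrArg α (Nat.add_assoc i j k).symm

theorem slice_suffix (n i j : ℕ) : slice (α.suffix n) i j = slice α (n + i) (n + j) := by
  simpa only [add_comm n, Nat.add_zero] using
    slice_add (α := α.suffix n) (β := α) (i := i) (j := j) (d := 0) (e := n)
      fun k _ _ => congrArg α (Nat.add_comm n k)

end InfWord

namespace SynTree

open scoped Computability

variable {AP : Type*}

/-- The language of a syntax tree, read as a regular expression. A negation denotes the complement
within the one-letter words; the empty language of the temporal operators is a junk value. -/
def lang : SynTree AP → Language (Finset AP)
  | .prop p => {x | ∃ A, p ∈ A ∧ x = [A]}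
  | .eps => 1
  | .neg t => {x | x.length = 1 ∧ x ∉ t.lang}
  | .or t₁ t₂ | .plus t₁ t₂ => t₁.lang + t₂.lang
  | .comp t₁ t₂ => t₁.lang * t₂.lang
  | .star t => t.lang∗
  | .next _ | .untl _ _ | .trig _ _ => 0

/-- Satisfaction of a syntax tree, read as a PSL formula, by an infinite word. The trees that are
proper regular expressions are junk, and satisfied by no word. -/
def Sat : InfWord AP → SynTree AP → Prop
  | α, .prop p => p ∈ α 0
  | α, .neg t => ¬ Sat α t
  | α, .or t₁ t₂ => Sat α t₁ ∨ Sat α t₂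
  | α, .next t => Sat (α.suffix 1) t
  | α, .untl t₁ t₂ => ∃ j, Sat (α.suffix j) t₂ ∧ ∀ i < j, Sat (α.suffix i) t₁
  | α, .trig t₁ t₂ => ∀ i, 0 < i → slice α 0 i ∈ t₁.lang → Sat (α.suffix (i - 1)) t₂
  | _, .eps | _, .plus _ _ | _, .comp _ _ | _, .star _ => False

theorem slice_mem_lang_prop {α : InfWord AP} {p : AP} {i j : ℕ} :
    slice α i j ∈ (prop p).lang ↔ j = i + 1 ∧ p ∈ α i := by
  constructor
  · rintro ⟨A, hA, h⟩
    obtain rfl : j = i + 1 := by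
      have := length_slice α i j
      rw [h, List.length_singleton] at this
      omega
    rw [slice_succ, List.singleton_inj] at h
    exact ⟨rfl, h ▸ hA⟩
  · rintro ⟨rfl, h⟩
    exact ⟨α i, h, slice_succ α i⟩

theorem slice_mem_lang_neg {α : InfWord AP} {t : SynTree AP} {i j : ℕ} :
    slice α i j ∈ (neg t).lang ↔ j = i + 1 ∧ slice α i j ∉ t.lang := by
  refine and_congr_left fun _ => ?_
  rw [length_slice]
  omega

theorem sat_untl_suffix {α : InfWord AP} {t₁ t₂ : SynTree AP} {i : ℕ} :
    (untl t₁ t₂).Sat (α.suffix i) ↔ ∃ j, i ≤ j ∧ t₂.Sat (α.suffix j) ∧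
      ∀ k, i ≤ k → k < j → t₁.Sat (α.suffix k) := by
  simp only [Sat, InfWord.suffix_suffix]
  constructor
  · rintro ⟨j, h₂, h₁⟩
    refine ⟨i + j, Nat.le_add_right i j, h₂, fun k hik hkj => ?_⟩
    obtain ⟨k, rfl⟩ := Nat.exists_eq_add_of_le hik
    exact h₁ k (by omega)
  · rintro ⟨j, hij, h₂, h₁⟩
    obtain ⟨j, rfl⟩ := Nat.exists_eq_add_of_le hij
    exact ⟨j, h₂, fun k hk => h₁ _ (Nat.le_add_right i k) (by omega)⟩

theorem sat_trig_suffix {α : InfWord AP} {t₁ t₂ : SynTree AP} {i : ℕ} :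
    (trig t₁ t₂).Sat (α.suffix i) ↔ ∀ j, i < j → slice α i j ∈ t₁.lang →
      t₂.Sat (α.suffix (j - 1)) := by
  simp only [Sat, InfWord.suffix_suffix, InfWord.slice_suffix, Nat.add_zero]
  constructor
  · intro h j hij hm
    obtain ⟨j, rfl⟩ := Nat.exists_eq_add_of_le hij.le
    rw [Nat.add_sub_assoc (by omega)]
    exact h j (by omega) hm
  · intro h j hj hm
    rw [← Nat.add_sub_assoc (by omega)]
    exact h _ (by omega) hm

end SynTree

section Agreement

open scoped Computability

variable {AP : Type*} {α : InfWord AP}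

theorem AtomExpr.mem_lang_tree (ξ : AtomExpr AP) (x : List (Finset AP)) :
    x ∈ ξ.tree.lang ↔ ∃ A ∈ ξ.sem, x = [A] := by
  induction ξ generalizing x with
  | prop p => exact Iff.rfl
  | neg ξ ih =>
    change x.length = 1 ∧ x ∉ ξ.tree.lang ↔ _
    rw [ih, List.length_eq_one_iff]
    constructor
    · rintro ⟨⟨A, rfl⟩, h⟩
      exact ⟨A, fun hA => h ⟨A, hA, rfl⟩, rfl⟩
    · rintro ⟨A, hA, rfl⟩
      refine ⟨⟨A, rfl⟩, ?_⟩
      rintro ⟨B, hB, h⟩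
      exact hA (List.singleton_inj.1 h ▸ hB)
  | or ξ₁ ξ₂ ih₁ ih₂ =>
    change x ∈ ξ₁.tree.lang + ξ₂.tree.lang ↔ _
    simp only [Language.mem_add, ih₁, ih₂, sem, Set.mem_union, or_and_right, exists_or]

theorem starMatch_iff_slice_mem_kstar {R : ℕ → ℕ → Prop} {L : Language (Finset AP)}
    (hR : ∀ i j, i ≤ j → (slice α i j ∈ L ↔ R i j)) {i j : ℕ} (hij : i ≤ j) :
    StarMatch R i j ↔ slice α i j ∈ L∗ := by
  constructor
  · intro h
    induction h with
    | refl i => exact (slice_mem_kstar le_rfl).2 (.inl rfl)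
    | step hik hkj h _ ih =>
      exact (slice_mem_kstar hij).2 (.inr ⟨_, ⟨hik, hkj⟩, (hR _ _ hik.le).2 h, ih hkj⟩)
  · intro h
    induction hd : j - i using Nat.strong_induction_on generalizing i with
    | _ d ih =>
      obtain rfl | ⟨k, ⟨hik, hkj⟩, hk, hk'⟩ := (slice_mem_kstar hij).1 h
      · exact .refl i
      · exact .step hik hkj ((hR i k hik.le).1 hk) (ih (j - k) (by omega) hkj hk' rfl)

theorem RegExpr.slice_mem_lang_tree (ρ : RegExpr AP) {i j : ℕ} (hij : i ≤ j) :
    slice α i j ∈ ρ.tree.lang ↔ Matches α ρ i j := by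
  induction ρ generalizing i j with
  | eps => exact (Language.mem_one _).trans ((slice_eq_nil hij).trans eq_comm)
  | atom ξ =>
    refine (ξ.mem_lang_tree _).trans ⟨?_, ?_⟩
    · rintro ⟨A, hA, h⟩
      have hlen := congrArg List.length h
      rw [length_slice, List.length_singleton] at hlen
      obtain rfl : j = i + 1 := by omega
      rw [slice_succ, List.singleton_inj] at h
      exact ⟨rfl, h ▸ hA⟩
    · rintro ⟨rfl, hA⟩
      exact ⟨_, hA, slice_succ α i⟩
  | plus ρ₁ ρ₂ ih₁ ih₂ => exact (Language.mem_add _ _ _).trans (or_congr (ih₁ hij) (ih₂ hij))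
  | comp ρ₁ ρ₂ ih₁ ih₂ =>
    refine (slice_mem_mul hij).trans (exists_congr fun k => ?_)
    rw [and_assoc]
    exact and_congr_right fun hik => and_congr_right fun hkj => and_congr (ih₁ hik) (ih₂ hkj)
  | star ρ ih => exact (starMatch_iff_slice_mem_kstar (fun _ _ => ih) hij).symm

theorem PSL.sat_tree (φ : PSL AP) (α : InfWord AP) : φ.tree.Sat α ↔ Sat α φ := by
  induction φ generalizing α with
  | prop p => exact Iff.rfl
  | neg φ ih => exact not_congr (ih α)
  | or φ₁ φ₂ ih₁ ih₂ => exact or_congr (ih₁ α) (ih₂ α)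
  | next _ ih => exact ih _
  | untl φ₁ φ₂ ih₁ ih₂ =>
    exact exists_congr fun j => and_congr (ih₂ _) (forall₂_congr fun i _ => ih₁ _)
  | trig ρ φ ih =>
    exact forall₂_congr fun i _ => imp_congr (ρ.slice_mem_lang_tree (Nat.zero_le i)) (ih _)

end Agreement

/-! ### Subtrees -/

namespace SynTree

variable {AP : Type*} [DecidableEq AP] {s t : SynTree AP}

theorem self_mem_subtrees (t : SynTree AP) : t ∈ t.subtrees := by
  cases t <;> simp [subtrees]

theorem sizeOf_le_of_mem_subtrees (h : s ∈ t.subtrees) : sizeOf s ≤ sizeOf t := by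
  induction t <;> simp only [subtrees, Finset.mem_insert, Finset.mem_union,
    Finset.mem_singleton] at h <;> grind

theorem eq_of_mem_subtrees_of_sizeOf_le (h : s ∈ t.subtrees) (hs : sizeOf t ≤ sizeOf s) :
    s = t := by
  cases t <;> simp only [subtrees, Finset.mem_insert, Finset.mem_union,
    Finset.mem_singleton] at h <;>
    grind [→ sizeOf_le_of_mem_subtrees]

theorem subtrees_subset (h : s ∈ t.subtrees) : s.subtrees ⊆ t.subtrees := by
  induction t <;> simp only [subtrees, Finset.mem_insert, Finset.mem_union,
    Finset.mem_singleton] at h ⊢ <;> grind [subtrees]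

theorem card_subtrees_lt (h : s ∈ t.subtrees) (hne : s ≠ t) :
    s.subtrees.card < t.subtrees.card := by
  refine Finset.card_lt_card (Finset.ssubset_iff_subset_ne.2 ⟨subtrees_subset h, fun he => hne ?_⟩)
  exact eq_of_mem_subtrees_of_sizeOf_le h
    (sizeOf_le_of_mem_subtrees (he ▸ t.self_mem_subtrees))

theorem two_pow_card_subtrees_add_le {u : SynTree AP}
    (hu : u.subtrees = insert u (s.subtrees ∪ t.subtrees))
    (hs : sizeOf s < sizeOf u) (ht : sizeOf t < sizeOf u) :
    2 ^ s.subtrees.card + 2 ^ t.subtrees.card ≤ 2 ^ u.subtrees.card := by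
  have hs : s.subtrees.card < u.subtrees.card :=
    card_subtrees_lt (by simp [hu, self_mem_subtrees]) (ne_of_apply_ne sizeOf hs.ne)
  have ht : t.subtrees.card < u.subtrees.card :=
    card_subtrees_lt (by simp [hu, self_mem_subtrees]) (ne_of_apply_ne sizeOf ht.ne)
  calc 2 ^ s.subtrees.card + 2 ^ t.subtrees.card
      ≤ 2 ^ (u.subtrees.card - 1) + 2 ^ (u.subtrees.card - 1) := by gcongr <;> omega
    _ = 2 ^ u.subtrees.card := by rw [← two_mul, mul_pow_sub_one (by omega)]

/-- Each operator adds up the states of its operands; since an operand may have almost as many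
subtrees as the whole tree, this may double the number of states. -/
theorem hasFactorization_lang (t : SynTree AP) : HasFactorization t.lang (2 ^ t.subtrees.card) := by
  induction t with
  | prop p =>
    refine (HasFactorization.of_length_eq_one ?_).mono Nat.one_le_two_pow
    rintro _ ⟨A, -, rfl⟩
    rfl
  | neg t =>
    exact (HasFactorization.of_length_eq_one fun x hx => hx.1).mono Nat.one_le_two_pow
  | eps => exact (HasFactorization.of_le_one le_rfl).mono (Nat.zero_le _)
  | next | untl | trig => exact (HasFactorization.of_le_one bot_le).mono (Nat.zero_le _)
  | or t₁ t₂ ih₁ ih₂ =>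
    exact (ih₁.add ih₂).mono (two_pow_card_subtrees_add_le rfl (by simp +arith) (by simp +arith))
  | plus t₁ t₂ ih₁ ih₂ =>
    exact (ih₁.add ih₂).mono (two_pow_card_subtrees_add_le rfl (by simp +arith) (by simp +arith))
  | comp t₁ t₂ ih₁ ih₂ =>
    exact (ih₁.mul ih₂).mono (two_pow_card_subtrees_add_le rfl (by simp +arith) (by simp +arith))
  | star t ih =>
    have hcard := Finset.card_le_card (Finset.subset_insert (star t) t.subtrees)
    exact ih.kstar.mono (Nat.pow_le_pow_right two_pos hcard)

end SynTree

/-! ### Periodicity -/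

section Until

variable {p q : ℕ → Prop} {L d i : ℕ}

theorem exists_first_until (h : ∃ j, i ≤ j ∧ q j ∧ ∀ k, i ≤ k → k < j → p k) :
    ∃ j, i ≤ j ∧ q j ∧ ∀ k, i ≤ k → k < j → p k ∧ ¬ q k := by
  classical
  obtain ⟨hij, hq, hp⟩ := Nat.find_spec h
  refine ⟨Nat.find h, hij, hq, fun k hik hkj => ⟨hp k hik hkj, fun hqk => ?_⟩⟩
  exact Nat.find_min h hkj ⟨hik, hqk, fun m him hmk => hp m him (hmk.trans hkj)⟩

theorem until_iff_of_le (hd : 0 < d) (hq : ∀ k, L ≤ k → (q (k + d) ↔ q k)) (hi : i ≤ L) :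
    (∃ j, i ≤ j ∧ q j ∧ ∀ k, i ≤ k → k < j → p k) ↔
      ∃ j, (i ≤ j ∧ j < L + d) ∧ q j ∧ ∀ k, i ≤ k ∧ k < j → p k := by
  constructor
  · intro h
    obtain ⟨j, hij, hqj, hj⟩ := exists_first_until h
    refine ⟨j, ⟨hij, ?_⟩, hqj, fun k hk => (hj k hk.1 hk.2).1⟩
    by_contra hjL
    refine (hj (j - d) (by omega) (by omega)).2 ?_
    rwa [← hq _ (by omega), Nat.sub_add_cancel (by omega)]
  · rintro ⟨j, hij, hqj, hj⟩
    exact ⟨j, hij.1, hqj, fun k hik hkj => hj k ⟨hik, hkj⟩⟩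

/-- A witness `j` of the until beyond the loop `[L, L + d)` corresponds to the witness `j - d < i`
in the loop, which is reached by going from `i` around the loop. -/
theorem until_iff_of_ge (hp : ∀ k, L ≤ k → (p (k + d) ↔ p k))
    (hq : ∀ k, L ≤ k → (q (k + d) ↔ q k)) (hLi : L ≤ i) (hi : i < L + d) :
    (∃ j, i ≤ j ∧ q j ∧ ∀ k, i ≤ k → k < j → p k) ↔
      ∃ j, (L ≤ j ∧ j < L + d) ∧ q j ∧
        ∀ k, (if i ≤ j then i ≤ k ∧ k < j else (L ≤ k ∧ k < j) ∨ (i ≤ k ∧ k < L + d)) → p k := by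
  constructor
  · intro h
    obtain ⟨j, hij, hqj, hj⟩ := exists_first_until h
    by_cases hjL : j < L + d
    · refine ⟨j, ⟨hLi.trans hij, hjL⟩, hqj, fun k hk => ?_⟩
      rw [if_pos hij] at hk
      exact (hj k hk.1 hk.2).1
    · have hqj' : q (j - d) := by rwa [← hq _ (by omega), Nat.sub_add_cancel (by omega)]
      have hji : ¬ i ≤ j - d := fun hij' => (hj _ hij' (by omega)).2 hqj'
      refine ⟨j - d, ⟨by omega, by omega⟩, hqj', fun k hk => ?_⟩
      rw [if_neg hji] at hk
      rcases hk with ⟨hLk, hkj⟩ | ⟨hik, hkL⟩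
      · exact (hp k hLk).1 (hj _ (by omega) (by omega)).1
      · exact (hj k hik (by omega)).1
  · rintro ⟨j, ⟨hLj, _⟩, hqj, hj⟩
    by_cases hij : i ≤ j
    · exact ⟨j, hij, hqj, fun k hik hkj => hj k (by rw [if_pos hij]; exact ⟨hik, hkj⟩)⟩
    · simp only [if_neg hij] at hj
      refine ⟨j + d, by omega, (hq j hLj).2 hqj, fun k hik hkj => ?_⟩
      by_cases hkL : k < L + d
      · exact hj k (.inr ⟨hik, hkL⟩)
      · obtain ⟨m, rfl⟩ := Nat.exists_eq_add_of_le' (show d ≤ k by omega)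
        exact (hp m (by omega)).2 (hj m (.inl (by omega)))

end Until

namespace UPWord

variable {AP : Type*} (w : UPWord AP)

theorem length_v_pos : 0 < w.v.length := List.length_pos_iff.2 w.v_ne

theorem luv_pos : 0 < w.luv := Nat.add_pos_right _ w.length_v_pos

theorem luvb_succ (b : ℕ) : w.luvb (b + 1) = w.luv + b * w.v.length := by
  rw [luvb, luv, add_one_mul]
  omega

theorem word_add_mul (e : ℕ) {i : ℕ} (hi : w.lu ≤ i) :
    w.word (i + e * w.v.length) = w.word i := by
  have hi : w.u.length ≤ i := hi
  simp only [word, dif_neg (show ¬ i < w.u.length by omega),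
    dif_neg (show ¬ i + e * w.v.length < w.u.length by omega), Nat.sub_add_comm hi,
    Nat.add_mul_mod_self_right]

theorem suffix_add_mul (e : ℕ) {i : ℕ} (hi : w.lu ≤ i) :
    w.word.suffix (i + e * w.v.length) = w.word.suffix i := by
  funext j
  rw [InfWord.suffix, InfWord.suffix, add_right_comm, w.word_add_mul e (by omega)]

theorem suffix_add_length {i : ℕ} (hi : w.lu ≤ i) :
    w.word.suffix (i + w.v.length) = w.word.suffix i := by
  simpa only [one_mul] using w.suffix_add_mul 1 hi

theorem M_lt_luv (j : ℕ) : w.M j < w.luv := by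
  unfold M
  split
  · assumption
  · exact Nat.add_lt_add_left (Nat.mod_lt _ w.length_v_pos) _

theorem suffix_M (j : ℕ) : w.word.suffix (w.M j) = w.word.suffix j := by
  unfold M
  split
  · rfl
  · next hj =>
    have hj : w.u.length ≤ j := by
      rw [luv] at hj
      omega
    conv_rhs => rw [← Nat.add_sub_cancel' hj, ← Nat.mod_add_div' (j - _) w.v.length, ← add_assoc]
    exact (w.suffix_add_mul _ (Nat.le_add_right _ _)).symm

/-- The bound leaves room for the `2 ^ n + 1` cuts of `HasFactorization.exists_shorter_slice`. -/
theorem exists_bounded_slice {L : Language (Finset AP)} {N i j : ℕ} (hL : HasFactorization L N)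
    (hi : i < w.luv) (hij : i < j) (h : slice w.word i j ∈ L) :
    ∃ j', i < j' ∧ j' ≤ w.luvb (N + 1) ∧ slice w.word i j' ∈ L ∧
      w.word.suffix (j' - 1) = w.word.suffix (j - 1) := by
  have hv := w.length_v_pos
  induction j using Nat.strong_induction_on with
  | _ j ih =>
    by_cases hj : j ≤ w.luvb (N + 1)
    · exact ⟨j, hij, hj, h, rfl⟩
    rw [luvb_succ] at hj
    obtain ⟨e, he, heN, h'⟩ := hL.exists_shorter_slice (p := w.luv) (d := w.v.length)
      (fun e k hk => w.word_add_mul e (le_trans (Nat.le_add_right _ _) hk)) hi (not_le.1 hj).le h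
    have hpos := Nat.mul_pos he hv
    have hle := Nat.mul_le_mul_right w.v.length heN
    obtain ⟨j', hij', hj', hm, hs⟩ := ih (j - e * w.v.length) (by omega) (by omega) h'
    refine ⟨j', hij', hj', hm, hs.trans ?_⟩
    have hlu : w.lu ≤ j - e * w.v.length - 1 := by
      rw [luv, ← lu] at hj
      omega
    rw [← w.suffix_add_mul e hlu]
    congr 1
    omega

variable {w} {t t₁ t₂ : SynTree AP} {n i : ℕ}

theorem sat_trig_iff [DecidableEq AP] (ht : t₁.subtrees.card ≤ n) (hi : i < w.luv) :
    (SynTree.trig t₁ t₂).Sat (w.word.suffix i) ↔ ∀ j, i < j ∧ j ≤ w.luvb (2 ^ n + 1) →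
      slice w.word i j ∈ t₁.lang → t₂.Sat (w.word.suffix (w.M (j - 1))) := by
  simp only [SynTree.sat_trig_suffix, suffix_M]
  refine ⟨fun h j hj => h j hj.1, fun h j hij hm => ?_⟩
  obtain ⟨j', hij', hj', hm', hs⟩ := w.exists_bounded_slice
    (t₁.hasFactorization_lang.mono (Nat.pow_le_pow_right two_pos ht)) hi hij hm
  exact hs ▸ h j' ⟨hij', hj'⟩ hm'

theorem sat_next_last :
    (SynTree.next t).Sat (w.word.suffix (w.luv - 1)) ↔ t.Sat (w.word.suffix w.lu) := by
  rw [SynTree.Sat, InfWord.suffix_suffix, Nat.sub_add_cancel w.luv_pos,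
    show w.word.suffix w.luv = w.word.suffix w.lu from w.suffix_add_length le_rfl]

theorem sat_add_length (t : SynTree AP) {k : ℕ} (hk : w.lu ≤ k) :
    t.Sat (w.word.suffix (k + w.v.length)) ↔ t.Sat (w.word.suffix k) := by
  rw [w.suffix_add_length hk]

theorem sat_untl_iff_of_lt (hi : i < w.lu) :
    (SynTree.untl t₁ t₂).Sat (w.word.suffix i) ↔ ∃ j, (i ≤ j ∧ j < w.luv) ∧
      t₂.Sat (w.word.suffix j) ∧ ∀ k, i ≤ k ∧ k < j → t₁.Sat (w.word.suffix k) :=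
  SynTree.sat_untl_suffix.trans
    (until_iff_of_le w.length_v_pos (fun _ => sat_add_length t₂) hi.le)

theorem mem_between {j k : ℕ} : k ∈ between w i j ↔
    if i ≤ j then i ≤ k ∧ k < j else (w.lu ≤ k ∧ k < j) ∨ (i ≤ k ∧ k < w.luv) := by
  unfold between
  split <;> simp only [List.mem_append, List.Ico.mem]

theorem sat_untl_iff_of_ge (hi : w.lu ≤ i) (hi' : i < w.luv) :
    (SynTree.untl t₁ t₂).Sat (w.word.suffix i) ↔ ∃ j, (w.lu ≤ j ∧ j < w.luv) ∧
      t₂.Sat (w.word.suffix j) ∧ ∀ k ∈ between w i j, t₁.Sat (w.word.suffix k) := by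
  simp only [mem_between]
  exact SynTree.sat_untl_suffix.trans
    (until_iff_of_ge (fun _ => sat_add_length t₁) (fun _ => sat_add_length t₂) hi hi')

end UPWord

/-! ### Unravelling a syntax DAG -/

/-- The labels of the inner nodes of a syntax tree. -/
def Label.IsInner {AP : Type*} : Label AP → Prop
  | .prop _ | .eps => False
  | _ => True

namespace SynTree

/-- The label of the root of a syntax tree. -/
def label {AP : Type*} : SynTree AP → Label AP
  | .prop p => .prop p
  | .eps => .eps
  | .neg _ => .neg
  | .or _ _ => .or
  | .next _ => .next
  | .untl _ _ => .untl
  | .trig _ _ => .trig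
  | .plus _ _ => .plus
  | .comp _ _ => .comp
  | .star _ => .star

end SynTree

namespace Unravels

variable {AP : Type*} {v : Var AP → Bool} {n k : ℕ} {t : SynTree AP}

theorem label (h : Unravels v k t) : v (.x k t.label) := by
  cases h <;> assumption

theorem exists_of_mem_subtrees [DecidableEq AP] {s : SynTree AP} (hk : 1 ≤ k)
    (h : Unravels v k t) (hs : s ∈ t.subtrees) : ∃ m, (1 ≤ m ∧ m ≤ k) ∧ Unravels v m s := by
  induction h with
  | prop | eps =>
    rw [Finset.mem_singleton.1 hs]
    exact ⟨_, ⟨hk, le_rfl⟩, by constructor; assumption⟩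
  | @neg k m t hx hm hl _ ih | @next k m t hx hm hl _ ih | @star k m t hx hm hl _ ih =>
    rcases Finset.mem_insert.1 hs with rfl | hs
    · exact ⟨k, ⟨hk, le_rfl⟩, by constructor <;> assumption⟩
    · obtain ⟨i, hi, h⟩ := ih hm.1 hs
      exact ⟨i, by omega, h⟩
  | @or k m m' t t' hx hm hl ht hm' hr ht' ih ih'
  | @untl k m m' t t' hx hm hl ht hm' hr ht' ih ih'
  | @trig k m m' t t' hx hm hl ht hm' hr ht' ih ih'
  | @plus k m m' t t' hx hm hl ht hm' hr ht' ih ih'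
  | @comp k m m' t t' hx hm hl ht hm' hr ht' ih ih' =>
    simp only [SynTree.subtrees, Finset.mem_insert, Finset.mem_union] at hs
    rcases hs with rfl | hs | hs
    · exact ⟨k, ⟨hk, le_rfl⟩, by constructor; exacts [hx, hm, hl, ht, hm', hr, ht']⟩
    · obtain ⟨i, hi, h⟩ := ih hm.1 hs
      exact ⟨i, by omega, h⟩
    · obtain ⟨i, hi, h⟩ := ih' hm'.1 hs
      exact ⟨i, by omega, h⟩

theorem unique [Fintype AP] (hS : IsSyntaxDAG v n) {t' : SynTree AP} (hk : 1 ≤ k) (hkn : k ≤ n)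
    (h : Unravels v k t) (h' : Unravels v k t') : t = t' := by
  induction h generalizing t' with
  | prop hx | eps hx =>
    have hlab := hS.label_unique hk hkn h'.label hx
    cases t' <;> simp only [SynTree.label, reduceCtorEq, Label.prop.injEq] at hlab
    first | rfl | rw [hlab]
  | @neg k m t hx hm hl _ ih | @next k m t hx hm hl _ ih | @star k m t hx hm hl _ ih =>
    have hlab := hS.label_unique hk hkn h'.label hx
    cases t' <;> simp only [SynTree.label, reduceCtorEq] at hlab
    cases h'
    next hx₁ hm₁ hl₁ h₁ =>
    cases hS.left_unique hkn ⟨hm, hl⟩ ⟨hm₁, hl₁⟩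
    rw [ih hm.1 (by omega) h₁]
  | @or k m m' t s hx hm hl _ hm' hr _ ih ih'
  | @untl k m m' t s hx hm hl _ hm' hr _ ih ih'
  | @trig k m m' t s hx hm hl _ hm' hr _ ih ih'
  | @plus k m m' t s hx hm hl _ hm' hr _ ih ih'
  | @comp k m m' t s hx hm hl _ hm' hr _ ih ih' =>
    have hlab := hS.label_unique hk hkn h'.label hx
    cases t' <;> simp only [SynTree.label, reduceCtorEq] at hlab
    cases h'
    next hx₁ hm₁ hl₁ hm₂ hr₂ h₁ h₂ =>
    cases hS.left_unique hkn ⟨hm, hl⟩ ⟨hm₁, hl₁⟩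
    cases hS.right_unique hkn ⟨hm', hr⟩ ⟨hm₂, hr₂⟩
    rw [ih hm.1 (by omega) h₁, ih' hm'.1 (by omega) h₂]

/-- Distinct subtrees unravel from distinct nodes below `k`. -/
theorem card_subtrees_le [DecidableEq AP] [Fintype AP] (hS : IsSyntaxDAG v n) (hk : 1 ≤ k)
    (hkn : k ≤ n) (h : Unravels v k t) : t.subtrees.card ≤ k := by
  choose! node node_mem unravels_node using
    fun s (hs : s ∈ t.subtrees) => h.exists_of_mem_subtrees hk hs
  have node_injOn : Set.InjOn node t.subtrees := fun s hs s' hs' he =>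
    (unravels_node s hs).unique hS (node_mem s hs).1 ((node_mem s hs).2.trans hkn)
      (he ▸ unravels_node s' hs')
  simpa only [Nat.card_Icc, Nat.add_sub_cancel] using
    Finset.card_le_card_of_injOn node
      (fun s hs => Finset.mem_coe.2 (Finset.mem_Icc.2 (node_mem s hs))) node_injOn

end Unravels

namespace IsSyntaxDAG

variable {AP : Type*} [Fintype AP] {v : Var AP → Bool} {n k : ℕ}

theorem exists_children (hS : IsSyntaxDAG v n) {c : Label AP} (hk : 1 ≤ k) (hkn : k ≤ n)
    (hc : v (.x k c)) (hinner : c.IsInner) :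
    ∃ m m', IsLeft v k m ∧ IsRight v k m' := by
  have hk2 : 2 ≤ k := by
    by_contra hk2
    obtain rfl : k = 1 := by omega
    rcases hS.leaf_one with h | ⟨p, h⟩ <;>
      rwa [hS.label_unique le_rfl hkn hc h] at hinner
  obtain ⟨m, hm⟩ := hS.exists_left hk2 hkn
  obtain ⟨m', hm'⟩ := hS.exists_right hk2 hkn
  exact ⟨m, m', hm, hm'⟩

theorem exists_unravels_atom (hS : IsSyntaxDAG v n) (hk : 1 ≤ k) (hkn : k ≤ n) (ha : v (.a k)) :
    ∃ ξ : AtomExpr AP, Unravels v k ξ.tree := by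
  induction k using Nat.strong_induction_on with
  | _ k ih =>
    obtain ⟨c, hc, hx⟩ := hS.atomic_label hk hkn ha
    rcases mem_labA.1 hc with rfl | rfl | ⟨p, rfl⟩
    · obtain ⟨m, _, hl, _⟩ := hS.exists_children hk hkn hx trivial
      obtain ⟨ξ, h⟩ := ih m hl.1.2 hl.1.1 (by have := hl.1; omega)
        (hS.atomic_left hkn (.inl rfl) ha hx hl)
      exact ⟨.neg ξ, .neg hx hl.1 hl.2 h⟩
    · obtain ⟨m, m', hl, hr⟩ := hS.exists_children hk hkn hx trivial
      obtain ⟨ξ, h⟩ := ih m hl.1.2 hl.1.1 (by have := hl.1; omega)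
        (hS.atomic_left hkn (.inr rfl) ha hx hl)
      obtain ⟨ξ', h'⟩ := ih m' hr.1.2 hr.1.1 (by have := hr.1; omega)
        (hS.atomic_right hkn ha hx hr)
      exact ⟨.or ξ ξ', .or hx hl.1 hl.2 h hr.1 hr.2 h'⟩
    · exact ⟨.prop p, .prop hx⟩

theorem exists_unravels_reg (hS : IsSyntaxDAG v n) (hk : 1 ≤ k) (hkn : k ≤ n)
    (hlab : ∃ c ∈ labR AP, v (.x k c))
    (hatom : ∀ d, d = .neg ∨ d = .or → v (.x k d) → v (.a k)) :
    ∃ ρ : RegExpr AP, Unravels v k ρ.tree := by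
  induction k using Nat.strong_induction_on with
  | _ k ih =>
    have of_left : ∀ {c m}, c = .plus ∨ c = .comp ∨ c = .star ∨ c = .trig → v (.x k c) →
        IsLeft v k m → (∃ d ∈ labR AP, v (.x m d)) → ∃ ρ : RegExpr AP, Unravels v m ρ.tree :=
      fun {c m} hc hx hl hm => ih m hl.1.2 hl.1.1 (by have := hl.1; omega) hm
        fun d => hS.left_atomic hkn hc hx hl
    have of_right : ∀ {c m}, c = .plus ∨ c = .comp → v (.x k c) →
        IsRight v k m → (∃ d ∈ labR AP, v (.x m d)) → ∃ ρ : RegExpr AP, Unravels v m ρ.tree :=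
      fun {c m} hc hx hr hm => ih m hr.1.2 hr.1.1 (by have := hr.1; omega) hm
        fun d => hS.right_atomic hkn hc hx hr
    obtain ⟨c, hc, hx⟩ := hlab
    rcases mem_labR.1 hc with rfl | rfl | rfl | rfl | rfl | rfl | ⟨p, rfl⟩
    · exact ⟨.eps, .eps hx⟩
    · obtain ⟨m, m', hl, hr⟩ := hS.exists_children hk hkn hx trivial
      obtain ⟨hm, hm'⟩ := hS.children_reg hkn (by simp) hx hl hr
      obtain ⟨ρ, h⟩ := of_left (by simp) hx hl hm
      obtain ⟨ρ', h'⟩ := of_right (by simp) hx hr hm'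
      exact ⟨.plus ρ ρ', .plus hx hl.1 hl.2 h hr.1 hr.2 h'⟩
    · obtain ⟨m, m', hl, hr⟩ := hS.exists_children hk hkn hx trivial
      obtain ⟨hm, hm'⟩ := hS.children_reg hkn (by simp) hx hl hr
      obtain ⟨ρ, h⟩ := of_left (by simp) hx hl hm
      obtain ⟨ρ', h'⟩ := of_right (by simp) hx hr hm'
      exact ⟨.comp ρ ρ', .comp hx hl.1 hl.2 h hr.1 hr.2 h'⟩
    · obtain ⟨m, m', hl, hr⟩ := hS.exists_children hk hkn hx trivial
      obtain ⟨ρ, h⟩ := of_left (by simp) hx hl (hS.children_reg hkn (by simp) hx hl hr).1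
      exact ⟨.star ρ, .star hx hl.1 hl.2 h⟩
    · exact (hS.exists_unravels_atom hk hkn (hatom _ (.inl rfl) hx)).imp' .atom fun _ => id
    · exact (hS.exists_unravels_atom hk hkn (hatom _ (.inr rfl) hx)).imp' .atom fun _ => id
    · exact ⟨.atom (.prop p), .prop hx⟩

theorem exists_unravels_psl (hS : IsSyntaxDAG v n) (hk : 1 ≤ k) (hkn : k ≤ n)
    (hlab : ∃ c ∈ labF AP, v (.x k c)) : ∃ φ : PSL AP, Unravels v k φ.tree := by
  induction k using Nat.strong_induction_on with
  | _ k ih =>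
    obtain ⟨c, hc, hx⟩ := hlab
    rcases eq_or_ne c .trig with rfl | hctrig
    · obtain ⟨m, m', hl, hr⟩ := hS.exists_children hk hkn hx trivial
      obtain ⟨hm, hm'⟩ := hS.children_trig hkn hx hl hr
      obtain ⟨ρ, h⟩ := hS.exists_unravels_reg hl.1.1 (by have := hl.1; omega) hm
        fun d => hS.left_atomic hkn (by simp) hx hl
      obtain ⟨φ, h'⟩ := ih m' hr.1.2 hr.1.1 (by have := hr.1; omega) hm'
      exact ⟨.trig ρ φ, .trig hx hl.1 hl.2 h hr.1 hr.2 h'⟩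
    by_cases hcprop : ∃ p, c = .prop p
    · obtain ⟨p, rfl⟩ := hcprop
      exact ⟨.prop p, .prop hx⟩
    have hc : c = .next ∨ c = .untl ∨ c = .neg ∨ c = .or := by
      have := mem_labF.1 hc
      tauto
    obtain ⟨m, m', hl, hr⟩ := hS.exists_children hk hkn hx
      (by rcases hc with rfl | rfl | rfl | rfl <;> trivial)
    obtain ⟨hm, hm'⟩ := hS.children_form hkn hc hx hl hr
    obtain ⟨φ, h⟩ := ih m hl.1.2 hl.1.1 (by have := hl.1; omega) hm
    obtain ⟨φ', h'⟩ := ih m' hr.1.2 hr.1.1 (by have := hr.1; omega) hm'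
    rcases hc with rfl | rfl | rfl | rfl
    · exact ⟨.next φ, .next hx hl.1 hl.2 h⟩
    · exact ⟨.untl φ φ', .untl hx hl.1 hl.2 h hr.1 hr.2 h'⟩
    · exact ⟨.neg φ, .neg hx hl.1 hl.2 h⟩
    · exact ⟨.or φ φ', .or hx hl.1 hl.2 h hr.1 hr.2 h'⟩

end IsSyntaxDAG

/-! ### Soundness of the encoding -/

section Soundness

variable {AP : Type*} {v : Var AP → Bool} {n k B i j : ℕ} {w : UPWord AP}

theorem AtomExpr.z_iff (hz : IsMatchTable v n w B) (ξ : AtomExpr AP) (hk : 1 ≤ k) (hkn : k ≤ n)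
    (h : Unravels v k ξ.tree) (hij : i ≤ j) (hj : j ≤ B) :
    v (.z w i j k) ↔ slice w.word i j ∈ ξ.tree.lang := by
  induction ξ generalizing k with
  | prop p =>
    cases h with | prop hx
    rw [hz.prop hk hkn hx hij hj, tree, SynTree.slice_mem_lang_prop]
  | neg ξ ih =>
    cases h with | neg hx hm hl h
    rw [hz.neg hkn hx ⟨hm, hl⟩ hij hj, ih hm.1 (by omega) h, tree, SynTree.slice_mem_lang_neg]
  | or ξ₁ ξ₂ ih₁ ih₂ =>
    cases h with | or hx hm hl h hm' hr h'
    rw [hz.or hkn hx ⟨hm, hl⟩ ⟨hm', hr⟩ hij hj, ih₁ hm.1 (by omega) h, ih₂ hm'.1 (by omega) h']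
    exact (Language.mem_add _ _ _).symm

theorem RegExpr.z_iff (hz : IsMatchTable v n w B) (ρ : RegExpr AP) (hk : 1 ≤ k) (hkn : k ≤ n)
    (h : Unravels v k ρ.tree) (hij : i ≤ j) (hj : j ≤ B) :
    v (.z w i j k) ↔ slice w.word i j ∈ ρ.tree.lang := by
  induction ρ generalizing k i j with
  | eps =>
    cases h with | eps hx
    rw [hz.eps hk hkn hx hij hj, ← slice_eq_nil hij]
    exact (Language.mem_one _).symm
  | atom ξ => exact ξ.z_iff hz hk hkn h hij hj
  | plus ρ₁ ρ₂ ih₁ ih₂ =>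
    cases h with | plus hx hm hl h hm' hr h'
    rw [hz.plus hkn hx ⟨hm, hl⟩ ⟨hm', hr⟩ hij hj, ih₁ hm.1 (by omega) h hij hj,
      ih₂ hm'.1 (by omega) h' hij hj]
    exact (Language.mem_add _ _ _).symm
  | comp ρ₁ ρ₂ ih₁ ih₂ =>
    cases h with | comp hx hm hl h hm' hr h'
    rw [hz.comp hkn hx ⟨hm, hl⟩ ⟨hm', hr⟩ hij hj]
    refine Iff.trans (exists_congr fun t => and_congr_right fun ht => ?_) (slice_mem_mul hij).symm
    exact and_congr (ih₁ hm.1 (by omega) h ht.1 (by omega)) (ih₂ hm'.1 (by omega) h' ht.2 hj)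
  | star ρ ih =>
    cases h with | star hx hm hl h
    induction hd : j - i using Nat.strong_induction_on generalizing i with
    | _ d ihd =>
      rw [hz.star hkn hx ⟨hm, hl⟩ hij hj]
      refine Iff.trans (or_congr_right ?_) (slice_mem_kstar hij).symm
      refine exists_congr fun t => and_congr_right fun ht => ?_
      exact and_congr (ih hm.1 (by omega) h ht.1.le (by omega))
        (ihd (j - t) (by omega) ht.2 rfl)

namespace IsSatTable

variable {t t₁ t₂ : SynTree AP} {m m' : ℕ} (hy : IsSatTable v n w B) (hkn : k ≤ n)
  (hl : IsLeft v k m) (hi : i < w.luv)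
include hy hkn hl hi

theorem y_next_iff (hx : v (.x k .next))
    (ht : ∀ i < w.luv, v (.y w i m) ↔ t.Sat (w.word.suffix i)) :
    v (.y w i k) ↔ (SynTree.next t).Sat (w.word.suffix i) := by
  by_cases hi' : i < w.luv - 1
  · rw [hy.next hkn hx hl hi', ht _ (by omega), SynTree.Sat, InfWord.suffix_suffix]
  · obtain rfl : i = w.luv - 1 := by omega
    rw [hy.next_last hkn hx hl, ht w.lu (Nat.lt_add_of_pos_right w.length_v_pos),
      UPWord.sat_next_last]

theorem y_untl_iff (hx : v (.x k .untl)) (hr : IsRight v k m')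
    (ht₁ : ∀ i < w.luv, v (.y w i m) ↔ t₁.Sat (w.word.suffix i))
    (ht₂ : ∀ i < w.luv, v (.y w i m') ↔ t₂.Sat (w.word.suffix i)) :
    v (.y w i k) ↔ (SynTree.untl t₁ t₂).Sat (w.word.suffix i) := by
  rcases lt_or_ge i w.lu with hi' | hi'
  · rw [hy.untl_of_lt hkn hx hl hr hi', UPWord.sat_untl_iff_of_lt hi']
    exact exists_congr fun j => and_congr_right fun hj => and_congr (ht₂ j hj.2)
      (forall₂_congr fun t ht => ht₁ t (by omega))
  · rw [hy.untl_of_ge hkn hx hl hr hi' hi, UPWord.sat_untl_iff_of_ge hi' hi]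
    refine exists_congr fun j => and_congr_right fun hj => and_congr (ht₂ j hj.2)
      (forall₂_congr fun t ht => ht₁ t ?_)
    rw [UPWord.mem_between] at ht
    split at ht <;> omega

end IsSatTable

theorem PSL.y_iff [Fintype AP] (hS : IsSyntaxDAG v n)
    (hz : IsMatchTable v n w (w.luvb (2 ^ n + 1))) (hy : IsSatTable v n w (w.luvb (2 ^ n + 1)))
    (φ : PSL AP) (hk : 1 ≤ k) (hkn : k ≤ n) (h : Unravels v k φ.tree) (hi : i < w.luv) :
    v (.y w i k) ↔ φ.tree.Sat (w.word.suffix i) := by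
  classical
  induction φ generalizing k i with
  | prop p =>
    cases h with | prop hx
    exact hy.prop hk hkn hx hi
  | neg φ ih =>
    cases h with | neg hx hm hl h
    exact (hy.neg hkn hx ⟨hm, hl⟩ hi).trans (not_congr (ih hm.1 (by omega) h hi))
  | or φ₁ φ₂ ih₁ ih₂ =>
    cases h with | or hx hm hl h hm' hr h'
    exact (hy.or hkn hx ⟨hm, hl⟩ ⟨hm', hr⟩ hi).trans
      (or_congr (ih₁ hm.1 (by omega) h hi) (ih₂ hm'.1 (by omega) h' hi))
  | next φ ih =>
    cases h with | next hx hm hl h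
    exact hy.y_next_iff hkn ⟨hm, hl⟩ hi hx fun _ => ih hm.1 (by omega) h
  | untl φ₁ φ₂ ih₁ ih₂ =>
    cases h with | untl hx hm hl h hm' hr h'
    exact hy.y_untl_iff hkn ⟨hm, hl⟩ hi hx ⟨hm', hr⟩ (fun _ => ih₁ hm.1 (by omega) h)
      fun _ => ih₂ hm'.1 (by omega) h'
  | trig ρ φ ih =>
    cases h with | trig hx hm hl h hm' hr h'
    have hcard := (h.card_subtrees_le hS hm.1 (by omega)).trans (hm.2.le.trans hkn)
    rw [hy.trig hkn hx ⟨hm, hl⟩ ⟨hm', hr⟩ hi, tree, UPWord.sat_trig_iff hcard hi]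
    exact forall₂_congr fun j hj => imp_congr (ρ.z_iff hz hm.1 (by omega) h hj.1.le hj.2)
      (ih hm'.1 (by omega) h' (w.M_lt_luv _))

end Soundness

/-! ### The formula of a model -/

section TreeInjective

variable {AP : Type*}

theorem AtomExpr.tree_injective : Function.Injective (AtomExpr.tree (AP := AP)) := by
  intro ξ ξ' h
  induction ξ generalizing ξ' <;> cases ξ' <;> simp only [tree, reduceCtorEq, SynTree.prop.injEq,
    SynTree.neg.injEq, SynTree.or.injEq] at h <;> grind

theorem RegExpr.tree_injective : Function.Injective (RegExpr.tree (AP := AP)) := by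
  intro ρ ρ' h
  induction ρ generalizing ρ' with
  | atom ξ =>
    cases ρ' with
    | atom ξ' => exact congrArg _ (AtomExpr.tree_injective h)
    | _ => cases ξ <;> simp [tree, AtomExpr.tree] at h
  | _ =>
    cases ρ' with
    | atom ξ' => cases ξ' <;> simp [tree, AtomExpr.tree] at h
    | _ => simp only [tree, reduceCtorEq, SynTree.plus.injEq, SynTree.comp.injEq,
        SynTree.star.injEq] at h <;> grind

theorem PSL.tree_injective : Function.Injective (PSL.tree (AP := AP)) := by
  intro φ φ' h
  induction φ generalizing φ' <;> cases φ' <;> simp only [tree, reduceCtorEq,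
    SynTree.prop.injEq, SynTree.neg.injEq, SynTree.or.injEq, SynTree.next.injEq,
    SynTree.untl.injEq, SynTree.trig.injEq] at h <;>
    grind [Function.Injective, RegExpr.tree_injective (AP := AP)]

end TreeInjective

section Extraction

variable {AP : Type*} [Fintype AP] {v : Var AP → Bool} {n : ℕ}

theorem exists_extracts (hS : IsSyntaxDAG v n) (hn : 1 ≤ n) : ∃ φ, Extracts v n φ :=
  hS.exists_unravels_psl hn le_rfl hS.root_form

theorem Extracts.unique (hS : IsSyntaxDAG v n) (hn : 1 ≤ n) {φ ψ : PSL AP}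
    (hφ : Extracts v n φ) (hψ : Extracts v n ψ) : φ = ψ :=
  PSL.tree_injective (Unravels.unique hS hn le_rfl hφ hψ)

variable [DecidableEq AP] {S : Sample AP}

theorem Extracts.size_le (hS : IsSyntaxDAG v n) (hn : 1 ≤ n) {φ : PSL AP} (hφ : Extracts v n φ) :
    φ.size ≤ n :=
  Unravels.card_subtrees_le hS hn le_rfl hφ

theorem holds_PhiWord {w : UPWord AP} : (PhiWord n w).Holds v ↔
    IsMatchTable v n w (w.luvb (2 ^ n + 1)) ∧ IsSatTable v n w (w.luvb (2 ^ n + 1)) := by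
  rw [PhiWord, holds_and, holds_PhiReg, holds_PhiLTL]

theorem holds_Phi : (Phi S n).Holds v ↔ IsSyntaxDAG v n ∧
    (∀ w ∈ S.P, (PhiWord n w).Holds v ∧ v (.y w 0 n)) ∧
      ∀ w ∈ S.N, (PhiWord n w).Holds v ∧ ¬ v (.y w 0 n) := by
  simp only [Phi, PhiCst, holds_and, holds_PhiStr, holds_bigAnd, Finset.mem_toList, holds_neg,
    holds_var]

theorem Extracts.y_zero_iff (hS : IsSyntaxDAG v n) (hn : 1 ≤ n) {φ : PSL AP}
    (hφ : Extracts v n φ) {w : UPWord AP} (hw : (PhiWord n w).Holds v) :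
    v (.y w 0 n) ↔ Sat w.word φ := by
  obtain ⟨hz, hy⟩ := holds_PhiWord.1 hw
  rw [φ.y_iff hS hz hy hn le_rfl hφ w.luv_pos, InfWord.suffix_zero, PSL.sat_tree]

theorem Extracts.consistent (hv : (Phi S n).Holds v) (hn : 1 ≤ n) {φ : PSL AP}
    (hφ : Extracts v n φ) : S.Consistent φ := by
  obtain ⟨hS, hP, hN⟩ := holds_Phi.1 hv
  exact ⟨fun w hw => (hφ.y_zero_iff hS hn (hP w hw).1).1 (hP w hw).2,
    fun w hw => mt (hφ.y_zero_iff hS hn (hN w hw).1).2 (hN w hw).2⟩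

end Extraction

/-! ### Syntactic categories -/

namespace SynTree

variable {AP : Type*}

/-- The syntax trees of atomic expressions. -/
def IsAtom : SynTree AP → Prop
  | .prop _ => True
  | .neg t => t.IsAtom
  | .or t₁ t₂ => t₁.IsAtom ∧ t₂.IsAtom
  | _ => False

/-- The syntax trees of regular expressions. -/
def IsReg : SynTree AP → Prop
  | .prop _ | .eps => True
  | .neg t => t.IsAtom
  | .or t₁ t₂ => t₁.IsAtom ∧ t₂.IsAtom
  | .plus t₁ t₂ | .comp t₁ t₂ => t₁.IsReg ∧ t₂.IsReg
  | .star t => t.IsReg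
  | _ => False

/-- The syntax trees of PSL formulas. -/
def IsForm : SynTree AP → Prop
  | .prop _ => True
  | .neg t | .next t => t.IsForm
  | .or t₁ t₂ | .untl t₁ t₂ => t₁.IsForm ∧ t₂.IsForm
  | .trig t₁ t₂ => t₁.IsReg ∧ t₂.IsForm
  | _ => False

/-- The syntax trees that occur in the syntax trees of PSL formulas. -/
def IsWellTyped (t : SynTree AP) : Prop := t.IsForm ∨ t.IsReg

end SynTree

section Trees

variable {AP : Type*}

theorem AtomExpr.isAtom_tree (ξ : AtomExpr AP) : ξ.tree.IsAtom := by
  induction ξ with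
  | prop => trivial
  | neg _ ih => exact ih
  | or ξ₁ ξ₂ ih₁ ih₂ => exact ⟨ih₁, ih₂⟩

theorem SynTree.IsAtom.isReg {t : SynTree AP} (h : t.IsAtom) : t.IsReg := by
  cases t <;> first | exact h | exact h.elim

theorem RegExpr.isReg_tree (ρ : RegExpr AP) : ρ.tree.IsReg := by
  induction ρ with
  | eps => trivial
  | atom ξ => exact ξ.isAtom_tree.isReg
  | plus ρ₁ ρ₂ ih₁ ih₂ | comp ρ₁ ρ₂ ih₁ ih₂ => exact ⟨ih₁, ih₂⟩
  | star _ ih => exact ih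

theorem PSL.isForm_tree (φ : PSL AP) : φ.tree.IsForm := by
  induction φ with
  | prop => trivial
  | neg _ ih | next _ ih => exact ih
  | or φ₁ φ₂ ih₁ ih₂ | untl φ₁ φ₂ ih₁ ih₂ => exact ⟨ih₁, ih₂⟩
  | trig ρ φ ih => exact ⟨ρ.isReg_tree, ih⟩

end Trees

namespace SynTree

variable {AP : Type*} {s t : SynTree AP}

/-- The left child of the root, its only child if the root is unary; a leaf is its own child. -/
def left : SynTree AP → SynTree AP
  | .prop p => .prop p
  | .eps => .eps
  | .neg t | .next t | .star t => t
  | .or t _ | .untl t _ | .trig t _ | .plus t _ | .comp t _ => t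

/-- The right child of the root, its only child if the root is unary; a leaf is its own child. -/
def right : SynTree AP → SynTree AP
  | .prop p => .prop p
  | .eps => .eps
  | .neg t | .next t | .star t => t
  | .or _ t | .untl _ t | .trig _ t | .plus _ t | .comp _ t => t

theorem IsAtom.left (h : t.IsAtom) : t.left.IsAtom := by
  cases t <;> first | exact h | exact h.1 | exact h.elim

theorem IsAtom.right (h : t.IsAtom) : t.right.IsAtom := by
  cases t <;> first | exact h | exact h.2 | exact h.elim

theorem IsAtom.isForm (h : t.IsAtom) : t.IsForm := by
  induction t with
  | prop => trivial
  | neg t ih => exact ih h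
  | or t₁ t₂ ih₁ ih₂ => exact ⟨ih₁ h.1, ih₂ h.2⟩
  | _ => exact h.elim

theorem IsReg.isAtom (h : t.IsReg) (ht : t.label = .neg ∨ t.label = .or) : t.IsAtom := by
  cases t <;> simp only [label, reduceCtorEq, or_self] at ht <;> exact h

theorem IsAtom.label_mem_labA [Fintype AP] (h : t.IsAtom) : t.label ∈ labA AP := by
  cases t <;> first | exact h.elim | simp [label, mem_labA]

theorem IsReg.label_mem_labR [Fintype AP] (h : t.IsReg) : t.label ∈ labR AP := by
  cases t <;> first | exact h.elim | simp [label, mem_labR]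

theorem IsForm.label_mem_labF [Fintype AP] (h : t.IsForm) : t.label ∈ labF AP := by
  cases t <;> first | exact h.elim | simp [label, mem_labF]

namespace IsWellTyped

theorem of_mem_subtrees [DecidableEq AP] (h : t.IsWellTyped) (hs : s ∈ t.subtrees) :
    s.IsWellTyped := by
  induction t <;> simp only [subtrees, Finset.mem_insert, Finset.mem_union,
    Finset.mem_singleton] at hs <;> grind [IsWellTyped, IsForm, IsReg, → IsAtom.isForm]

theorem isReg_left (h : t.IsWellTyped)
    (ht : t.label = .plus ∨ t.label = .comp ∨ t.label = .star ∨ t.label = .trig) :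
    t.left.IsReg := by
  cases t <;> simp only [label, reduceCtorEq, or_self] at ht <;>
    simp_all only [IsWellTyped, IsForm, IsReg, SynTree.left, false_or, or_false]

theorem isReg_right (h : t.IsWellTyped)
    (ht : t.label = .plus ∨ t.label = .comp ∨ t.label = .star) : t.right.IsReg := by
  cases t <;> simp only [label, reduceCtorEq, or_self] at ht <;>
    simp_all only [IsWellTyped, IsForm, IsReg, SynTree.right, false_or]

theorem isForm_left (h : t.IsWellTyped)
    (ht : t.label = .next ∨ t.label = .untl ∨ t.label = .neg ∨ t.label = .or) :
    t.left.IsForm := by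
  cases t <;> simp only [label, reduceCtorEq, or_self] at ht
  case neg => exact h.elim id IsAtom.isForm
  case or => exact h.elim And.left fun h => h.1.isForm
  case next => exact h.resolve_right id
  case untl => exact (h.resolve_right id).1

theorem isForm_right (h : t.IsWellTyped) (ht : t.label = .next ∨ t.label = .untl ∨
    t.label = .neg ∨ t.label = .or ∨ t.label = .trig) : t.right.IsForm := by
  cases t <;> simp only [label, reduceCtorEq, or_self] at ht
  case neg => exact h.elim id IsAtom.isForm
  case or => exact h.elim And.right fun h => h.2.isForm
  case next => exact h.resolve_right id
  case untl | trig => exact (h.resolve_right id).2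

end IsWellTyped

end SynTree

/-! ### Numbering the subtrees of a syntax tree -/

/-- The syntax tree with root label `c` and children `t₁` and `t₂`, of which a unary label uses
only the first and a leaf label none. -/
def Label.build {AP : Type*} (t₁ t₂ : SynTree AP) : Label AP → SynTree AP
  | .prop p => .prop p
  | .eps => .eps
  | .neg => .neg t₁
  | .or => .or t₁ t₂
  | .next => .next t₁
  | .untl => .untl t₁ t₂
  | .trig => .trig t₁ t₂
  | .plus => .plus t₁ t₂
  | .comp => .comp t₁ t₂
  | .star => .star t₁

namespace SynTree

variable {AP : Type*}

theorem build_label (t : SynTree AP) : t.label.build t.left t.right = t := by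
  cases t <;> rfl

theorem sizeOf_left_lt {t : SynTree AP} (h : t.label.IsInner) : sizeOf t.left < sizeOf t := by
  cases t <;> first | exact h.elim | (simp [left]; try omega)

theorem sizeOf_right_lt {t : SynTree AP} (h : t.label.IsInner) : sizeOf t.right < sizeOf t := by
  cases t <;> first | exact h.elim | simp [right]

variable [DecidableEq AP] {s s' t : SynTree AP} {k : ℕ}

theorem left_mem_subtrees (t : SynTree AP) : t.left ∈ t.subtrees := by
  cases t <;> simp [left, subtrees, self_mem_subtrees]

theorem right_mem_subtrees (t : SynTree AP) : t.right ∈ t.subtrees := by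
  cases t <;> simp [right, subtrees, self_mem_subtrees]

/-- The distinct subtrees of `t`, in an order in which smaller subtrees precede larger ones. -/
noncomputable def subtreeList (t : SynTree AP) : List (SynTree AP) :=
  t.subtrees.toList.mergeSort fun s s' => sizeOf s ≤ sizeOf s'

theorem mem_subtreeList : s ∈ t.subtreeList ↔ s ∈ t.subtrees := by
  rw [subtreeList, List.mem_mergeSort, Finset.mem_toList]

theorem length_subtreeList (t : SynTree AP) : t.subtreeList.length = t.subtrees.card := by
  rw [subtreeList, List.length_mergeSort, Finset.length_toList]

theorem pairwise_subtreeList (t : SynTree AP) :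
    t.subtreeList.Pairwise fun s s' => sizeOf s ≤ sizeOf s' := by
  refine (List.pairwise_mergeSort (fun _ _ _ h h' => ?_) (fun s s' => ?_) _).imp of_decide_eq_true
  · exact decide_eq_true ((of_decide_eq_true h).trans (of_decide_eq_true h'))
  · simpa only [Bool.or_eq_true, decide_eq_true_eq] using le_total (sizeOf s) (sizeOf s')

/-- The subtree of `t` with number `k`, where `1 ≤ k ≤ t.subtrees.card`; junk value `t`. -/
noncomputable def node (t : SynTree AP) (k : ℕ) : SynTree AP := t.subtreeList.getD (k - 1) t

/-- The number of the subtree `s` of `t`, counted from `1`. -/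
noncomputable def idx (t s : SynTree AP) : ℕ := t.subtreeList.idxOf s + 1

theorem node_eq_getElem (hk : 1 ≤ k) (hkn : k ≤ t.subtrees.card) :
    t.node k = t.subtreeList[k - 1]'(by rw [length_subtreeList]; omega) :=
  List.getD_eq_getElem _ _ _

theorem one_le_idx : 1 ≤ t.idx s := Nat.le_add_left _ _

theorem node_mem (hk : 1 ≤ k) (hkn : k ≤ t.subtrees.card) : t.node k ∈ t.subtrees := by
  rw [node_eq_getElem hk hkn, ← mem_subtreeList]
  exact List.getElem_mem _

theorem idx_le (hs : s ∈ t.subtrees) : t.idx s ≤ t.subtrees.card := by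
  rw [← length_subtreeList]
  exact List.idxOf_lt_length_iff.2 (mem_subtreeList.2 hs)

theorem node_idx (hs : s ∈ t.subtrees) : t.node (t.idx s) = s := by
  rw [node_eq_getElem one_le_idx (idx_le hs)]
  exact List.getElem_idxOf _

theorem sizeOf_node_le_of_le {m : ℕ} (hm : 1 ≤ m) (hmk : m ≤ k) (hkn : k ≤ t.subtrees.card) :
    sizeOf (t.node m) ≤ sizeOf (t.node k) := by
  rcases hmk.eq_or_lt with rfl | hmk
  · exact le_rfl
  rw [node_eq_getElem hm (hmk.le.trans hkn), node_eq_getElem (hm.trans hmk.le) hkn]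
  exact List.pairwise_iff_getElem.1 t.pairwise_subtreeList _ _ _ _ (by omega)

theorem idx_lt_of_sizeOf_lt (hk : 1 ≤ k) (hs : s ∈ t.subtrees)
    (h : sizeOf s < sizeOf (t.node k)) : t.idx s < k := by
  by_contra! hle
  have := sizeOf_node_le_of_le hk hle (idx_le hs)
  rw [node_idx hs] at this
  omega

theorem one_le_card_subtrees (t : SynTree AP) : 1 ≤ t.subtrees.card :=
  Finset.card_pos.2 ⟨t, t.self_mem_subtrees⟩

theorem node_card (t : SynTree AP) : t.node t.subtrees.card = t := by
  refine eq_of_mem_subtrees_of_sizeOf_le (node_mem t.one_le_card_subtrees le_rfl) ?_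
  have := sizeOf_node_le_of_le one_le_idx (idx_le t.self_mem_subtrees) le_rfl
  rwa [node_idx t.self_mem_subtrees] at this

theorem left_node_mem (hk : 1 ≤ k) (hkn : k ≤ t.subtrees.card) : (t.node k).left ∈ t.subtrees :=
  subtrees_subset (node_mem hk hkn) (left_mem_subtrees _)

theorem right_node_mem (hk : 1 ≤ k) (hkn : k ≤ t.subtrees.card) : (t.node k).right ∈ t.subtrees :=
  subtrees_subset (node_mem hk hkn) (right_mem_subtrees _)

/-! ### The model given by a syntax tree -/

open Classical in
/-- The interpretation that describes the syntax DAG of the numbered subtrees of `t` and their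
semantics. The encoding wants two children of every node `k ≥ 2`, so a leaf, which is its own
child, gets the child `k - 1` instead. -/
noncomputable def model (t : SynTree AP) : Var AP → Bool
  | .x k c => (t.node k).label = c
  | .l k m => m = min (t.idx (t.node k).left) (k - 1)
  | .r k m => m = min (t.idx (t.node k).right) (k - 1)
  | .a k => (t.node k).IsAtom
  | .y w i k => (t.node k).Sat (w.word.suffix i)
  | .z w i j k => slice w.word i j ∈ (t.node k).lang

theorem model_x {c : Label AP} : t.model (.x k c) ↔ (t.node k).label = c := by simp [model]

theorem model_a : t.model (.a k) ↔ (t.node k).IsAtom := by simp [model]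

theorem model_y {w : UPWord AP} {i : ℕ} :
    t.model (.y w i k) ↔ (t.node k).Sat (w.word.suffix i) := by simp [model]

theorem model_z {w : UPWord AP} {i j : ℕ} :
    t.model (.z w i j k) ↔ slice w.word i j ∈ (t.node k).lang := by simp [model]

theorem isLeft_model {m : ℕ} (hk : 2 ≤ k) :
    IsLeft t.model k m ↔ m = min (t.idx (t.node k).left) (k - 1) := by
  have := one_le_idx (t := t) (s := (t.node k).left)
  simp only [IsLeft, model, decide_eq_true_eq]
  omega

theorem isRight_model {m : ℕ} (hk : 2 ≤ k) :
    IsRight t.model k m ↔ m = min (t.idx (t.node k).right) (k - 1) := by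
  have := one_le_idx (t := t) (s := (t.node k).right)
  simp only [IsRight, model, decide_eq_true_eq]
  omega

variable {m m' : ℕ} {c : Label AP}

theorem node_of_isLeft (hkn : k ≤ t.subtrees.card) (hx : t.model (.x k c)) (hc : c.IsInner)
    (hl : IsLeft t.model k m) : t.node m = (t.node k).left := by
  have hk := hl.two_le
  have hleft := left_node_mem (by omega) hkn
  have hlt := idx_lt_of_sizeOf_lt (by omega) hleft
    (sizeOf_left_lt (by rwa [model_x.1 hx]))
  rw [(isLeft_model hk).1 hl, min_eq_left (by omega), node_idx hleft]

theorem node_of_isRight (hkn : k ≤ t.subtrees.card) (hx : t.model (.x k c)) (hc : c.IsInner)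
    (hr : IsRight t.model k m) : t.node m = (t.node k).right := by
  have hk := hr.two_le
  have hright := right_node_mem (by omega) hkn
  have hlt := idx_lt_of_sizeOf_lt (by omega) hright
    (sizeOf_right_lt (by rwa [model_x.1 hx]))
  rw [(isRight_model hk).1 hr, min_eq_left (by omega), node_idx hright]

theorem node_eq_build (hx : t.model (.x k c)) :
    t.node k = c.build (t.node k).left (t.node k).right := by
  rw [← model_x.1 hx, build_label]

theorem node_eq_build_of_isLeft (hkn : k ≤ t.subtrees.card)
    (hx : t.model (.x k c)) (hc : c.IsInner) (hl : IsLeft t.model k m) :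
    t.node k = c.build (t.node m) (t.node k).right := by
  rw [node_of_isLeft hkn hx hc hl]
  exact node_eq_build hx

theorem node_eq_build_of_isLeft_isRight (hkn : k ≤ t.subtrees.card)
    (hx : t.model (.x k c)) (hc : c.IsInner) (hl : IsLeft t.model k m) (hr : IsRight t.model k m') :
    t.node k = c.build (t.node m) (t.node m') := by
  rw [node_of_isLeft hkn hx hc hl, node_of_isRight hkn hx hc hr]
  exact node_eq_build hx

end SynTree

/-! ### Completeness of the encoding -/

namespace SynTree

open scoped Computability

variable {AP : Type*} [DecidableEq AP] {t : SynTree AP}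

theorem isMatchTable_model (t : SynTree AP) (w : UPWord AP) (B : ℕ) :
    IsMatchTable t.model t.subtrees.card w B where
  eps _ _ hx hij _ := by
    rw [model_z, node_eq_build hx]
    exact (Language.mem_one _).trans (slice_eq_nil hij)
  prop _ _ hx _ _ := by
    rw [model_z, node_eq_build hx]
    exact slice_mem_lang_prop
  neg hkn hx hl _ _ := by
    rw [model_z, model_z, node_eq_build_of_isLeft hkn hx trivial hl]
    exact slice_mem_lang_neg
  or hkn hx hl hr _ _ := by
    rw [model_z, model_z, model_z,
      node_eq_build_of_isLeft_isRight hkn hx trivial hl hr]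
    exact Language.mem_add _ _ _
  plus hkn hx hl hr _ _ := by
    rw [model_z, model_z, model_z,
      node_eq_build_of_isLeft_isRight hkn hx trivial hl hr]
    exact Language.mem_add _ _ _
  comp hkn hx hl hr hij _ := by
    simp only [model_z]
    rw [node_eq_build_of_isLeft_isRight hkn hx trivial hl hr]
    exact slice_mem_mul hij
  star hkn hx hl hij _ := by
    simp only [model_z]
    rw [node_eq_build_of_isLeft hkn hx trivial hl]
    exact slice_mem_kstar hij

theorem isSatTable_model (t : SynTree AP) (w : UPWord AP) :
    IsSatTable t.model t.subtrees.card w (w.luvb (2 ^ t.subtrees.card + 1)) where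
  prop _ _ hx _ := by
    rw [model_y, node_eq_build hx]
    exact Iff.rfl
  neg hkn hx hl _ := by
    rw [model_y, model_y, node_eq_build_of_isLeft hkn hx trivial hl]
    exact Iff.rfl
  or hkn hx hl hr _ := by
    rw [model_y, model_y, model_y,
      node_eq_build_of_isLeft_isRight hkn hx trivial hl hr]
    exact Iff.rfl
  next hkn hx hl _ := by
    rw [model_y, model_y, node_eq_build_of_isLeft hkn hx trivial hl,
      ← InfWord.suffix_suffix]
    exact Iff.rfl
  next_last hkn hx hl := by
    rw [model_y, model_y, node_eq_build_of_isLeft hkn hx trivial hl]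
    exact UPWord.sat_next_last
  untl_of_lt hkn hx hl hr hi := by
    simp only [model_y]
    rw [node_eq_build_of_isLeft_isRight hkn hx trivial hl hr]
    exact UPWord.sat_untl_iff_of_lt hi
  untl_of_ge hkn hx hl hr hi hi' := by
    simp only [model_y]
    rw [node_eq_build_of_isLeft_isRight hkn hx trivial hl hr]
    exact UPWord.sat_untl_iff_of_ge hi hi'
  trig {k m _ i} hkn hx hl hr hi := by
    simp only [model_y, model_z]
    rw [node_eq_build_of_isLeft_isRight hkn hx trivial hl hr]
    have hm : t.node m ∈ t.subtrees := node_mem hl.1.1 (hl.1.2.le.trans hkn)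
    exact UPWord.sat_trig_iff (Finset.card_le_card (subtrees_subset hm)) hi

variable {k m : ℕ} {c : Label AP}

theorem leaf_node_one (t : SynTree AP) :
    (t.node 1).label = .eps ∨ ∃ p, (t.node 1).label = .prop p := by
  have h : ¬ (t.node 1).label.IsInner := fun h => absurd one_le_idx
    (idx_lt_of_sizeOf_lt le_rfl (left_node_mem le_rfl t.one_le_card_subtrees)
      (sizeOf_left_lt h)).not_ge
  generalize (t.node 1).label = c at h
  cases c with
  | eps => exact .inl rfl
  | prop p => exact .inr ⟨p, rfl⟩
  | _ => exact (h trivial).elim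

namespace IsWellTyped

theorem node (ht : t.IsWellTyped) (hk : 1 ≤ k) (hkn : k ≤ t.subtrees.card) :
    (t.node k).IsWellTyped :=
  ht.of_mem_subtrees (node_mem hk hkn)

variable (ht : t.IsWellTyped) (hkn : k ≤ t.subtrees.card) (hx : t.model (.x k c))
include ht hkn hx

theorem isReg_node_of_isLeft (hc : c = .plus ∨ c = .comp ∨ c = .star ∨ c = .trig)
    (hl : IsLeft t.model k m) : (t.node m).IsReg := by
  rw [node_of_isLeft hkn hx (by rcases hc with rfl | rfl | rfl | rfl <;> trivial) hl]
  rw [← model_x.1 hx] at hc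
  exact (ht.node (one_le_two.trans hl.two_le) hkn).isReg_left hc

theorem isReg_node_of_isRight (hc : c = .plus ∨ c = .comp ∨ c = .star)
    (hr : IsRight t.model k m) : (t.node m).IsReg := by
  rw [node_of_isRight hkn hx (by rcases hc with rfl | rfl | rfl <;> trivial) hr]
  rw [← model_x.1 hx] at hc
  exact (ht.node (one_le_two.trans hr.two_le) hkn).isReg_right hc

theorem isForm_node_of_isLeft (hc : c = .next ∨ c = .untl ∨ c = .neg ∨ c = .or)
    (hl : IsLeft t.model k m) : (t.node m).IsForm := by
  rw [node_of_isLeft hkn hx (by rcases hc with rfl | rfl | rfl | rfl <;> trivial) hl]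
  rw [← model_x.1 hx] at hc
  exact (ht.node (one_le_two.trans hl.two_le) hkn).isForm_left hc

theorem isForm_node_of_isRight (hc : c = .next ∨ c = .untl ∨ c = .neg ∨ c = .or ∨ c = .trig)
    (hr : IsRight t.model k m) : (t.node m).IsForm := by
  rw [node_of_isRight hkn hx (by rcases hc with rfl | rfl | rfl | rfl | rfl <;> trivial) hr]
  rw [← model_x.1 hx] at hc
  exact (ht.node (one_le_two.trans hr.two_le) hkn).isForm_right hc

end IsWellTyped

theorem IsForm.isSyntaxDAG_model [Fintype AP] (ht : t.IsForm) :
    IsSyntaxDAG t.model t.subtrees.card := by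
  have wt : t.IsWellTyped := .inl ht
  constructor
  case exists_label => exact fun _ _ => ⟨_, model_x.2 rfl⟩
  case label_unique => exact fun _ _ hx hx' => (model_x.1 hx).symm.trans (model_x.1 hx')
  case exists_left => exact fun hk _ => ⟨_, (isLeft_model hk).2 rfl⟩
  case exists_right => exact fun hk _ => ⟨_, (isRight_model hk).2 rfl⟩
  case left_unique =>
    exact fun _ hl hl' =>
      ((isLeft_model hl.two_le).1 hl).trans ((isLeft_model hl.two_le).1 hl').symm
  case right_unique =>
    exact fun _ hr hr' =>
      ((isRight_model hr.two_le).1 hr).trans ((isRight_model hr.two_le).1 hr').symm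
  case children_reg =>
    exact fun hkn hc hx hl hr =>
      ⟨⟨_, (wt.isReg_node_of_isLeft hkn hx (by tauto) hl).label_mem_labR, model_x.2 rfl⟩,
        _, (wt.isReg_node_of_isRight hkn hx (by tauto) hr).label_mem_labR, model_x.2 rfl⟩
  case children_form =>
    exact fun hkn hc hx hl hr =>
      ⟨⟨_, (wt.isForm_node_of_isLeft hkn hx hc hl).label_mem_labF, model_x.2 rfl⟩,
        _, (wt.isForm_node_of_isRight hkn hx (by tauto) hr).label_mem_labF, model_x.2 rfl⟩
  case children_trig =>
    exact fun hkn hx hl hr =>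
      ⟨⟨_, (wt.isReg_node_of_isLeft hkn hx (by tauto) hl).label_mem_labR, model_x.2 rfl⟩,
        _, (wt.isForm_node_of_isRight hkn hx (by tauto) hr).label_mem_labF, model_x.2 rfl⟩
  case atomic_label =>
    exact fun _ _ ha => ⟨_, (model_a.1 ha).label_mem_labA, model_x.2 rfl⟩
  case atomic_left =>
    intro k m c hkn hc ha hx hl
    rw [model_a, node_of_isLeft hkn hx (by rcases hc with rfl | rfl <;> trivial) hl]
    exact (model_a.1 ha).left
  case atomic_right =>
    intro k m hkn ha hx hr
    rw [model_a, node_of_isRight hkn hx trivial hr]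
    exact (model_a.1 ha).right
  case left_atomic =>
    exact fun hkn hc hx hl hd hxd => model_a.2 <|
      (wt.isReg_node_of_isLeft hkn hx hc hl).isAtom (by rwa [model_x.1 hxd])
  case right_atomic =>
    exact fun hkn hc hx hr hd hxd => model_a.2 <|
      (wt.isReg_node_of_isRight hkn hx (by tauto) hr).isAtom (by rwa [model_x.1 hxd])
  case leaf_one => simpa only [model_x] using t.leaf_node_one
  case root_form => exact ⟨_, ht.label_mem_labF, by rw [model_x, node_card]⟩

end SynTree

theorem satisfiable_of_consistent {AP : Type*} [DecidableEq AP] [Fintype AP] {S : Sample AP}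
    {φ : PSL AP} (hφ : S.Consistent φ) : (Phi S φ.size).Satisfiable := by
  have hw (w : UPWord AP) : (PhiWord φ.size w).Holds φ.tree.model :=
    holds_PhiWord.2 ⟨SynTree.isMatchTable_model _ _ _, SynTree.isSatTable_model _ _⟩
  have hy (w : UPWord AP) : φ.tree.model (.y w 0 φ.size) ↔ Sat w.word φ := by
    rw [SynTree.model_y, PSL.size, SynTree.node_card, InfWord.suffix_zero, PSL.sat_tree]
  exact ⟨φ.tree.model, holds_Phi.2 ⟨φ.isForm_tree.isSyntaxDAG_model,
    fun w h => ⟨hw w, (hy w).2 (hφ.1 w h)⟩, fun w h => ⟨hw w, mt (hy w).1 (hφ.2 w h)⟩⟩⟩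

/-! ### Consistent formulas and their sizes -/

section Consistency

variable {AP : Type*}

theorem PSL.size_or_self [DecidableEq AP] (φ : PSL AP) : (φ.or φ).size = φ.size + 1 := by
  rw [size, tree, SynTree.subtrees, Finset.union_self, Finset.card_insert_of_notMem, size]
  intro h
  have := SynTree.sizeOf_le_of_mem_subtrees h
  rw [SynTree.or.sizeOf_spec] at this
  omega

theorem Sample.exists_consistent_of_size_le [DecidableEq AP] {S : Sample AP} {φ : PSL AP}
    (hφ : S.Consistent φ) {n : ℕ} (hn : φ.size ≤ n) : ∃ ψ, S.Consistent ψ ∧ ψ.size = n := by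
  induction n, hn using Nat.le_induction with
  | base => exact ⟨φ, hφ, rfl⟩
  | succ n _ ih =>
    obtain ⟨ψ, h, rfl⟩ := ih
    refine ⟨ψ.or ψ, ?_, ψ.size_or_self⟩
    simpa only [Sample.Consistent, Sat, or_self] using h

theorem exists_sat_iff_sat_suffix (φ : PSL AP) (i : ℕ) :
    ∃ ψ : PSL AP, ∀ α : InfWord AP, Sat α ψ ↔ Sat (α.suffix i) φ := by
  induction i with
  | zero => exact ⟨φ, fun α => by rw [InfWord.suffix_zero]⟩
  | succ i ih =>
    obtain ⟨ψ, h⟩ := ih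
    exact ⟨.next ψ, fun α => by rw [Sat, h, InfWord.suffix_suffix, add_comm]⟩

theorem exists_sat_not_sat {α β : InfWord AP} (h : α ≠ β) :
    ∃ φ : PSL AP, Sat α φ ∧ ¬ Sat β φ := by
  obtain ⟨i, hi⟩ := Function.ne_iff.1 h
  obtain ⟨p, hp⟩ := not_forall.1 (mt Finset.ext hi)
  obtain ⟨ψ, hψ⟩ := exists_sat_iff_sat_suffix (.prop p) i
  have hne : ¬ (Sat α ψ ↔ Sat β ψ) := by rwa [hψ, hψ]
  by_cases hα : Sat α ψ
  · exact ⟨ψ, hα, fun hβ => hne (iff_of_true hα hβ)⟩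
  · exact ⟨.neg ψ, hα, fun hβ => hne (iff_of_false hα hβ)⟩

variable [Nonempty AP]

/-- The disjunction of a list of formulas, ending in a contradiction `¬(p ∨ ¬p)` because PSL has
no constant for falsity. -/
noncomputable def PSL.disjunction (l : List (PSL AP)) : PSL AP :=
  let p := PSL.prop (Classical.arbitrary AP)
  l.foldr .or (.neg (.or p (.neg p)))

theorem PSL.sat_disjunction {α : InfWord AP} {l : List (PSL AP)} :
    Sat α (disjunction l) ↔ ∃ φ ∈ l, Sat α φ := by
  induction l with
  | nil => exact iff_of_false (fun h => h (em _)) fun ⟨_, h, _⟩ => List.not_mem_nil h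
  | cons φ l ih =>
    rw [List.exists_mem_cons_iff]
    exact or_congr_right ih

theorem Sample.exists_consistent (S : Sample AP) : ∃ φ, S.Consistent φ := by
  have : Nonempty (PSL AP) := ⟨.prop (Classical.arbitrary AP)⟩
  choose! sep sat_left not_sat_right using fun (α β : InfWord AP) (h : α ≠ β) =>
    exists_sat_not_sat h
  let φ : PSL AP := .disjunction (S.P.toList.map fun w =>
    .neg (.disjunction (S.N.toList.map fun w' => .neg (sep w.word w'.word))))
  have sat_φ (α : InfWord AP) :
      Sat α φ ↔ ∃ w ∈ S.P, ∀ w' ∈ S.N, Sat α (sep w.word w'.word) := by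
    simp only [φ, PSL.sat_disjunction, Sat, List.mem_map, Finset.mem_toList,
      exists_exists_and_eq_and, not_exists, not_and, not_not]
  refine ⟨φ, fun w hw => (sat_φ _).2 ⟨w, hw, fun w' hw' => ?_⟩, fun w' hw' h => ?_⟩
  · exact sat_left _ _ (S.disjoint w hw w' hw')
  · obtain ⟨w, hw, h⟩ := (sat_φ _).1 h
    exact not_sat_right _ _ (S.disjoint w hw w' hw') (h w' hw')

end Consistency

/-! ### Runs of the algorithm -/

section Runs

variable {AP : Type*} [Fintype AP] [DecidableEq AP] {S : Sample AP}

theorem satisfiable_iff_exists_consistent {n : ℕ} (hn : 1 ≤ n) :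
    (Phi S n).Satisfiable ↔ ∃ φ, S.Consistent φ ∧ φ.size = n := by
  constructor
  · rintro ⟨v, hv⟩
    have hS := (holds_Phi.1 hv).1
    obtain ⟨φ, hφ⟩ := exists_extracts hS hn
    exact Sample.exists_consistent_of_size_le (hφ.consistent hv hn) (hφ.size_le hS hn)
  · rintro ⟨φ, h, rfl⟩
    exact satisfiable_of_consistent h

/-- What holds of the configurations that occur in runs: the values of the counter that have been
passed gave unsatisfiable formulas, and a model or a formula stems from the next one. -/
def Config.Invariant (S : Sample AP) : Config AP → Prop
  | .loop n => ∀ m, 1 ≤ m → m ≤ n → ¬ (Phi S m).Satisfiable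
  | .solved n v => 1 ≤ n ∧ (Phi S n).Holds v ∧ ∀ m, 1 ≤ m → m < n → ¬ (Phi S m).Satisfiable
  | .returned φ => ∃ n v, 1 ≤ n ∧ (Phi S n).Holds v ∧ Extracts v n φ ∧
      ∀ m, 1 ≤ m → m < n → ¬ (Phi S m).Satisfiable

theorem Reachable.invariant {c : Config AP} (h : Reachable S c) : c.Invariant S := by
  induction h with
  | refl => exact fun m h₁ h₂ => absurd (h₁.trans h₂) (Nat.not_succ_le_zero 0)
  | tail _ hstep ih =>
    cases hstep with
    | @unsat n h =>
      intro m h₁ h₂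
      rcases h₂.lt_or_eq with hm | rfl
      exacts [ih m h₁ (Nat.le_of_lt_succ hm), h]
    | @sat n v h => exact ⟨Nat.le_add_left 1 n, h, fun m h₁ h₂ => ih m h₁ (Nat.le_of_lt_succ h₂)⟩
    | @ret n v φ h => exact ⟨n, v, ih.1, ih.2.1, h, ih.2.2⟩

theorem Reachable.eq_returned {c : Config AP} (h : Reachable S c) (hc : ∀ c', ¬ Step S c c') :
    ∃ φ, c = .returned φ := by
  cases c with
  | loop n =>
    by_cases hs : (Phi S (n + 1)).Satisfiable
    · obtain ⟨v, hv⟩ := hs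
      exact (hc _ (.sat hv)).elim
    · exact (hc _ (.unsat hs)).elim
  | solved n v =>
    obtain ⟨hn, hv, -⟩ := h.invariant
    obtain ⟨φ, hφ⟩ := exists_extracts (holds_Phi.1 hv).1 hn
    exact (hc _ (.ret hφ)).elim
  | returned φ => exact ⟨φ, rfl⟩

theorem Reachable.consistent_and_minimal {φ : PSL AP} (h : Reachable S (.returned φ)) :
    S.Consistent φ ∧ ∀ ψ, S.Consistent ψ → φ.size ≤ ψ.size := by
  obtain ⟨n, v, hn, hv, hφ, hmin⟩ := h.invariant
  refine ⟨hφ.consistent hv hn, fun ψ hψ => (hφ.size_le (holds_Phi.1 hv).1 hn).trans ?_⟩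
  by_contra! hlt
  exact hmin ψ.size ψ.tree.one_le_card_subtrees hlt (satisfiable_of_consistent hψ)

theorem eq_loop_of_infinite_run {c : ℕ → Config AP} (hc₀ : c 0 = .loop 0)
    (hc : ∀ i, Step S (c i) (c (i + 1))) (i : ℕ) : c i = .loop i := by
  induction i with
  | zero => exact hc₀
  | succ i ih =>
    have h₁ := hc i
    have h₂ := hc (i + 1)
    have h₃ := hc (i + 1 + 1)
    rw [ih] at h₁
    generalize c (i + 1) = d at *
    generalize c (i + 1 + 1) = d' at *
    cases h₁ with
    | unsat => rfl
    | sat =>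
      cases h₂
      cases h₃

theorem not_exists_infinite_run [Nonempty AP] : ¬ ∃ c : ℕ → Config AP,
    c 0 = .loop 0 ∧ ∀ i, Step S (c i) (c (i + 1)) := by
  rintro ⟨c, hc₀, hc⟩
  obtain ⟨φ, hφ⟩ := S.exists_consistent
  obtain ⟨k, hk⟩ := Nat.exists_eq_add_of_le' φ.tree.one_le_card_subtrees
  have h := hc k
  rw [eq_loop_of_infinite_run hc₀ hc, eq_loop_of_infinite_run hc₀ hc] at h
  cases h with
  | unsat h => exact h (hk ▸ satisfiable_of_consistent hφ)

end Runs

end PSLLearning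

theorem mainTheorem1 {AP : Type*} [Fintype AP] [DecidableEq AP] [Nonempty AP]
    (S : PSLLearning.Sample AP) :
    -- every run of the algorithm is finite
    (¬ ∃ c : ℕ → PSLLearning.Config AP,
      c 0 = .loop 0 ∧ ∀ i, PSLLearning.Step S (c i) (c (i + 1))) ∧
    -- a run can only stop by returning a formula
    (∀ c, PSLLearning.Reachable S c → (∀ c', ¬ PSLLearning.Step S c c') →
      ∃ φ, c = .returned φ) ∧
    -- every returned formula is consistent with `S` and of minimal size
    (∀ φ, PSLLearning.Reachable S (.returned φ) →
      S.Consistent φ ∧ ∀ ψ, S.Consistent ψ → φ.size ≤ ψ.size) ∧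
    -- the encoding is satisfiable exactly for the sizes of consistent formulas, and every model
    -- of it determines a formula, which is consistent
    (∀ n, 1 ≤ n →
      ((PSLLearning.Phi S n).Satisfiable ↔ ∃ φ, S.Consistent φ ∧ φ.size = n) ∧
      ∀ v, (PSLLearning.Phi S n).Holds v →
        ∃ φ, PSLLearning.Extracts v n φ ∧ (∀ ψ, PSLLearning.Extracts v n ψ → ψ = φ) ∧
          S.Consistent φ ∧ φ.size ≤ n) := by
  refine ⟨PSLLearning.not_exists_infinite_run, fun _ hc => hc.eq_returned,
    fun _ hφ => hφ.consistent_and_minimal, fun n hn =>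
      ⟨PSLLearning.satisfiable_iff_exists_consistent hn, fun v hv => ?_⟩⟩
  have hS : PSLLearning.IsSyntaxDAG v n := (PSLLearning.holds_Phi.1 hv).1
  obtain ⟨φ, hφ⟩ := PSLLearning.exists_extracts hS hn
  exact ⟨φ, hφ, fun _ hψ => hψ.unique hS hn hφ, hφ.consistent hv hn, hφ.size_le hS hn⟩
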